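/- Let $X$ be a smooth projective toric variety over an algebraically closed field $k$, with Cox ring $S$ (graded by $\operatorname{Pic}(X)$) and irrelevant ideal $B$. Let $M$ be a finitely generated $\operatorname{Pic}(X)$-graded $S$-module with associated coherent sheaf $\widetilde M$ on $X$. A virtual resolution of $M$ is a complex $F_\bullet=[F_0\leftarrow F_1\leftarrow\cdots]$ of finitely generated $\operatorname{Pic}(X)$-graded free $S$-modules such that $\widetilde F_\bullet$ is a locally free resolution of $\widetilde M$; $\operatorname{vdim} M$ is the minimal length of a virtual resolution of $M$; and $\operatorname{codim} M$ is the codimension of $\operatorname{Spec}(S/\operatorname{Ann}_S M)$ in $\operatorname{Spec} S$. The module $M$ is - arithmetically Cohen–Macaulay if it is a Cohen–Macaulay $S$-module; - virtually Cohen–Macaulay if $\widetilde M\neq 0$ and $\operatorname{vdim} M=\operatorname{codim} M$; - geometrically Cohen–Macaulay if $M_P$ is a Cohen–Macaulay $S_P$-module for every prime $P$ in the support of $M$ that is relevant, i.e. $B^t\not\subseteq P$ for all $t\ge 1$. Then: 1. if $M$ is arithmetically Cohen–Macaulay and $\widetilde M\neq 0$, then $M$ is virtually Cohen–Macaulay;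 2. if $M$ is virtually Cohen–Macaulay, then $M$ is geometrically Cohen–Macaulay. -/

import Mathlib

/-! ### Depth and Cohen–Macaulay modules -/

/-- The depth of a module `N` over a local ring `A`: the supremum of the lengths of the
`N`-regular sequences contained in the maximal ideal. -/
noncomputable def localDepth (A : Type*) [CommRing A] [IsLocalRing A]
    (N : Type*) [AddCommGroup N] [Module A N] : ℕ∞ :=
  ⨆ (rs : List A) (_ : (∀ r ∈ rs, r ∈ IsLocalRing.maximalIdeal A) ∧
    RingTheory.Sequence.IsRegular N rs), (rs.length : ℕ∞)

/-- A (finitely generated) module over a (Noetherian) local ring is Cohen–Macaulay if it is zero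
or its depth equals its Krull dimension (the dimension of its support). -/
def IsLocalCohenMacaulay (A : Type*) [CommRing A] [IsLocalRing A]
    (N : Type*) [AddCommGroup N] [Module A N] : Prop :=
  Subsingleton N ∨ (localDepth A N : WithBot ℕ∞) = Module.supportDim A N

/-- The localization `N_P` is a Cohen–Macaulay `A_P`-module. -/
def IsCohenMacaulayAt (A : Type*) [CommRing A] (N : Type*) [AddCommGroup N] [Module A N]
    (P : PrimeSpectrum A) : Prop :=
  IsLocalCohenMacaulay (Localization.AtPrime P.asIdeal)
    (LocalizedModule P.asIdeal.primeCompl N)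

/-- A module over a (Noetherian) ring is Cohen–Macaulay if all its localizations at primes in its
support are. -/
def IsCohenMacaulayModule (A : Type*) [CommRing A] (N : Type*) [AddCommGroup N] [Module A N] :
    Prop :=
  ∀ P ∈ Module.support A N, IsCohenMacaulayAt A N P

/-! ### Smooth projective toric varieties -/

/-- The cone in `ℝ^d` spanned by the lattice vectors `v ρ`, `ρ ∈ σ`. -/
def realCone {d : ℕ} {R : Type*} (v : R → Fin d → ℤ) (σ : Finset R) : Set (Fin d → ℝ) :=
  {u | ∃ c : R → ℝ, (∀ ρ, 0 ≤ c ρ) ∧ u = ∑ ρ ∈ σ, c ρ • (fun i => (v ρ i : ℝ))}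

/-- A `d`-dimensional smooth projective toric variety, given by its fan in the lattice `ℤ^d`.
The finite type `R` indexes the rays; as the cones of a smooth fan are simplicial, each is
recorded by the set of its rays. -/
structure SmoothProjectiveFan (d : ℕ) (R : Type*) [Fintype R] [DecidableEq R] where
  /-- the primitive generator of each ray -/
  ray : R → Fin d → ℤ
  /-- the cones of the fan -/
  cones : Set (Finset R)
  /-- every ray is a cone of the fan -/
  ray_mem : ∀ ρ, {ρ} ∈ cones
  /-- a face of a cone is a cone -/
  face_mem : ∀ σ ∈ cones, ∀ τ ⊆ σ, τ ∈ cones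
  /-- two cones meet in their common face -/
  inter : ∀ σ ∈ cones, ∀ τ ∈ cones,
    realCone ray σ ∩ realCone ray τ = realCone ray (σ ∩ τ)
  /-- smoothness: the generators of each cone are part of a `ℤ`-basis of the lattice -/
  smooth : ∀ σ ∈ cones, ∃ (b : Module.Basis (Fin d) ℤ (Fin d → ℤ)) (j : σ ↪ Fin d),
    ∀ ρ : σ, b (j ρ) = ray ρ
  /-- completeness: the cones cover `ℝ^d` -/
  complete : ∀ u : Fin d → ℝ, ∃ σ ∈ cones, u ∈ realCone ray σ
  /-- projectivity: some torus-invariant divisor `∑ a_ρ D_ρ` is ample, i.e. its support function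
  is strictly convex -/
  projective : ∃ a : R → ℤ, ∀ σ ∈ cones, σ.card = d → ∃ m : Fin d → ℤ,
    (∀ ρ ∈ σ, ∑ i, m i * ray ρ i = -a ρ) ∧ (∀ ρ ∉ σ, -a ρ < ∑ i, m i * ray ρ i)

namespace SmoothProjectiveFan

variable {d : ℕ} {R : Type*} [Fintype R] [DecidableEq R] (X : SmoothProjectiveFan d R)

/-- The map sending a character `m` to the principal divisor `∑ ⟨m, v_ρ⟩ D_ρ` of `χ^m`. -/
def divHom : (Fin d → ℤ) →+ (R → ℤ) where
  toFun m := fun ρ => ∑ i, m i * X.ray ρ i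
  map_zero' := by ext; simp
  map_add' m m' := by ext; simp [add_mul, Finset.sum_add_distrib]

/-- `Pic(X)`: torus-invariant divisors modulo the divisors of characters. (`X` being smooth, this
divisor class group is the Picard group.) -/
def Pic : Type _ := (R → ℤ) ⧸ X.divHom.range

noncomputable instance : AddCommGroup X.Pic :=
  inferInstanceAs (AddCommGroup ((R → ℤ) ⧸ X.divHom.range))

noncomputable instance : DecidableEq X.Pic := Classical.decEq _

/-- The class in `Pic(X)` of the prime divisor `D_ρ`. -/
def divClass (ρ : R) : X.Pic := QuotientAddGroup.mk' X.divHom.range (Pi.single ρ 1)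

/-- The Cox ring `S = k[x_ρ]` of `X`. -/
abbrev Cox (_ : SmoothProjectiveFan d R) (k : Type*) [Field k] : Type _ := MvPolynomial R k

variable (k : Type*) [Field k]

/-- The `Pic(X)`-grading of the Cox ring, in which `x_ρ` has degree `[D_ρ]`. -/
noncomputable def coxGrading (α : X.Pic) : Submodule k (X.Cox k) :=
  MvPolynomial.weightedHomogeneousSubmodule k X.divClass α

instance : SetLike.GradedMonoid (X.coxGrading k) :=
  MvPolynomial.WeightedHomogeneousSubmodule.gradedMonoid

/-- The monomial `∏ x_ρ` over the rays `ρ` not in `σ`. -/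
noncomputable def coneMonomial (σ : Finset R) : X.Cox k := ∏ ρ ∈ σᶜ, MvPolynomial.X ρ

/-- The degree of `coneMonomial σ`. -/
noncomputable def coneDeg (σ : Finset R) : X.Pic := ∑ ρ ∈ σᶜ, X.divClass ρ

/-- The irrelevant ideal `B`. -/
noncomputable def irrelevantIdeal : Ideal (X.Cox k) :=
  Ideal.span {f | ∃ σ ∈ X.cones, f = X.coneMonomial k σ}

lemma prod_X_mem (s : Finset R) :
    (∏ ρ ∈ s, MvPolynomial.X ρ : X.Cox k) ∈ X.coxGrading k (∑ ρ ∈ s, X.divClass ρ) :=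
  SetLike.prod_mem_graded _ _ _
    (fun ρ _ => MvPolynomial.isWeightedHomogeneous_X k X.divClass ρ)

lemma coneMonomial_pow_mem (σ : Finset R) (n : ℕ) :
    X.coneMonomial k σ ^ n ∈ X.coxGrading k (n • X.coneDeg σ) :=
  SetLike.pow_mem_graded n (X.prod_X_mem k σᶜ)

lemma coneMonomial_mul {σ τ : Finset R} (h : τ ⊆ σ) :
    X.coneMonomial k τ = (∏ ρ ∈ σ \ τ, MvPolynomial.X ρ) * X.coneMonomial k σ := by
  rw [coneMonomial, coneMonomial, ← Finset.prod_union]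
  · congr 1
    ext ρ
    have := @h ρ
    simp only [Finset.mem_compl, Finset.mem_union, Finset.mem_sdiff]
    tauto
  · rw [Finset.disjoint_left]
    intro ρ
    simp only [Finset.mem_compl, Finset.mem_sdiff]
    tauto

lemma coneDeg_add {σ τ : Finset R} (h : τ ⊆ σ) :
    X.coneDeg τ = (∑ ρ ∈ σ \ τ, X.divClass ρ) + X.coneDeg σ := by
  rw [coneDeg, coneDeg, ← Finset.sum_union]
  · congr 1
    ext ρ
    have := @h ρ
    simp only [Finset.mem_compl, Finset.mem_union, Finset.mem_sdiff]
    tauto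
  · rw [Finset.disjoint_left]
    intro ρ
    simp only [Finset.mem_compl, Finset.mem_sdiff]
    tauto

/-- The multiplicative set of powers of `coneMonomial σ`. -/
noncomputable abbrev coneSub (σ : Finset R) : Submonoid (X.Cox k) := Submonoid.powers (X.coneMonomial k σ)

/-- The element `(coneMonomial σ)^n` of `coneSub σ`. -/
noncomputable def conePow (σ : Finset R) (n : ℕ) : X.coneSub k σ := ⟨X.coneMonomial k σ ^ n, n, rfl⟩

/-- The coordinate ring of the affine chart `U_σ` of `X`: the degree zero part of the
localization of `S` at `coneMonomial σ`. -/
noncomputable def chartRing (σ : Finset R) : Subring (Localization (X.coneSub k σ)) where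
  carrier := {z | ∃ n : ℕ, ∃ a ∈ X.coxGrading k (n • X.coneDeg σ),
    z = Localization.mk a (X.conePow k σ n)}
  zero_mem' := ⟨0, 0, Submodule.zero_mem _, (Localization.mk_zero _).symm⟩
  one_mem' := ⟨0, 1, by simpa using SetLike.one_mem_graded (X.coxGrading k), by
    rw [← Localization.mk_one]; congr 1⟩
  add_mem' := by
    rintro _ _ ⟨n, a, ha, rfl⟩ ⟨m, b, hb, rfl⟩
    refine ⟨n + m, X.coneMonomial k σ ^ n * b + X.coneMonomial k σ ^ m * a,
      Submodule.add_mem _ ?_ ?_, ?_⟩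
    · rw [add_smul]
      exact SetLike.mul_mem_graded (X.coneMonomial_pow_mem k σ n) hb
    · rw [add_comm, add_smul]
      exact SetLike.mul_mem_graded (X.coneMonomial_pow_mem k σ m) ha
    · rw [Localization.add_mk]
      congr 1
      ext
      simp [conePow, pow_add]
  neg_mem' := by
    rintro _ ⟨n, a, ha, rfl⟩
    exact ⟨n, -a, Submodule.neg_mem _ ha, Localization.neg_mk _ _⟩
  mul_mem' := by
    rintro _ _ ⟨n, a, ha, rfl⟩ ⟨m, b, hb, rfl⟩
    refine ⟨n + m, a * b, by rw [add_smul]; exact SetLike.mul_mem_graded ha hb, ?_⟩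
    rw [Localization.mk_mul]
    congr 1
    ext
    simp [conePow, pow_add]

/-! ### Graded modules and their sheaves

For a `Pic(X)`-graded `S`-module `M`, the quasi-coherent sheaf `M~` on `X` is given on the affine
open cover of `X` by the charts `U_σ`, where `U_σ ∩ U_τ = U_{σ ∩ τ}`: its module of sections on
`U_σ` is the degree zero part of the localization of `M` at `coneMonomial σ`. -/

section Sheaf

variable {M : Type*} [AddCommGroup M] [Module (X.Cox k) M] (ℳ : X.Pic → AddSubgroup M)
  [SetLike.GradedSMul (X.coxGrading k) ℳ]
variable {N : Type*} [AddCommGroup N] [Module (X.Cox k) N] (𝒩 : X.Pic → AddSubgroup N)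
  [SetLike.GradedSMul (X.coxGrading k) 𝒩]

lemma smul_mem_graded {α β γ : X.Pic} (h : γ = α + β) {a : X.Cox k} {m : M}
    (ha : a ∈ X.coxGrading k α) (hm : m ∈ ℳ β) : a • m ∈ ℳ γ := by
  subst h
  exact SetLike.GradedSMul.smul_mem ha hm

/-- The sections of `M~` on the chart `U_σ`, as a module over the coordinate ring of `U_σ`. -/
noncomputable def sections (σ : Finset R) :
    Submodule (X.chartRing k σ) (LocalizedModule (X.coneSub k σ) M) where
  carrier := {z | ∃ n : ℕ, ∃ m ∈ ℳ (n • X.coneDeg σ), z = LocalizedModule.mk m (X.conePow k σ n)}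
  zero_mem' := ⟨0, 0, zero_mem _, (LocalizedModule.zero_mk _).symm⟩
  add_mem' := by
    rintro _ _ ⟨n, a, ha, rfl⟩ ⟨m, b, hb, rfl⟩
    refine ⟨n + m, X.coneMonomial k σ ^ m • a + X.coneMonomial k σ ^ n • b,
      add_mem ?_ ?_, ?_⟩
    · exact X.smul_mem_graded k ℳ (by rw [add_comm, add_smul]) (X.coneMonomial_pow_mem k σ m) ha
    · exact X.smul_mem_graded k ℳ (by rw [add_smul]) (X.coneMonomial_pow_mem k σ n) hb
    · rw [LocalizedModule.mk_add_mk]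
      congr 1
      ext
      simp [conePow, pow_add]
  smul_mem' := by
    rintro ⟨_, n, a, ha, rfl⟩ _ ⟨m, b, hb, rfl⟩
    refine ⟨n + m, a • b, X.smul_mem_graded k ℳ (by rw [add_smul]) ha hb, ?_⟩
    rw [Subring.smul_def]
    refine (LocalizedModule.mk_smul_mk a b _ _).trans ?_
    congr 1
    ext
    simp [conePow, pow_add]

/-- For `τ ⊆ σ`, powers of `coneMonomial σ` are invertible on the localization at
`coneMonomial τ`. -/
lemma isUnit_coneSub {σ τ : Finset R} (h : τ ⊆ σ) (s : X.coneSub k σ) :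
    IsUnit (algebraMap (X.Cox k)
      (Module.End (X.Cox k) (LocalizedModule (X.coneSub k τ) M)) s) := by
  obtain ⟨_, n, rfl⟩ := s
  have h1 := IsLocalizedModule.map_units
    (LocalizedModule.mkLinearMap (X.coneSub k τ) M) (X.conePow k τ n)
  have h2 : ((X.conePow k τ n : X.coneSub k τ) : X.Cox k) =
      (∏ ρ ∈ σ \ τ, MvPolynomial.X ρ) ^ n * X.coneMonomial k σ ^ n := by
    rw [← mul_pow, ← X.coneMonomial_mul k h]
    rfl
  rw [h2, map_mul] at h1
  exact (((Commute.all _ _).map (algebraMap (X.Cox k)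
    (Module.End (X.Cox k) (LocalizedModule (X.coneSub k τ) M)))).isUnit_mul_iff.mp h1).2

/-- For `τ ⊆ σ`, the canonical map from the localization at `coneMonomial σ` to the localization
at its multiple `coneMonomial τ`. -/
noncomputable def locRes (M : Type*) [AddCommGroup M] [Module (X.Cox k) M]
    {σ τ : Finset R} (h : τ ⊆ σ) :
    LocalizedModule (X.coneSub k σ) M →ₗ[X.Cox k] LocalizedModule (X.coneSub k τ) M :=
  LocalizedModule.lift (X.coneSub k σ) (LocalizedModule.mkLinearMap (X.coneSub k τ) M)
    (X.isUnit_coneSub k h)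

lemma locRes_mk {σ τ : Finset R} (h : τ ⊆ σ) (m : M) (n : ℕ) :
    X.locRes k M h (LocalizedModule.mk m (X.conePow k σ n)) =
      LocalizedModule.mk ((∏ ρ ∈ σ \ τ, MvPolynomial.X ρ : X.Cox k) ^ n • m)
        (X.conePow k τ n) := by
  rw [locRes, LocalizedModule.lift_mk, Module.End.algebraMap_isUnit_inv_apply_eq_iff,
    LocalizedModule.mkLinearMap_apply, LocalizedModule.smul'_mk, LocalizedModule.mk_eq]
  refine ⟨1, ?_⟩
  simp only [one_smul, Submonoid.smul_def, conePow, smul_smul, X.coneMonomial_mul k h, mul_pow]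
  congr 1
  ring

/-- The restriction map of `M~` from the chart `U_σ` to the smaller chart `U_τ`, `τ ⊆ σ`. -/
noncomputable def sectionsRes {σ τ : Finset R} (h : τ ⊆ σ) (z : X.sections k ℳ σ) :
    X.sections k ℳ τ :=
  ⟨X.locRes k M h z, by
    obtain ⟨_, n, m, hm, rfl⟩ := z
    refine ⟨n, _, ?_, X.locRes_mk k h m n⟩
    refine X.smul_mem_graded k ℳ ?_ (SetLike.pow_mem_graded n (X.prod_X_mem k (σ \ τ))) hm
    rw [← smul_add, ← X.coneDeg_add h]⟩

/-- A morphism of sheaves `M~ → N~`: linear maps on the sections over all charts, compatible with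
restriction. -/
structure SheafHom where
  /-- the map on sections over `U_σ` -/
  app : ∀ σ ∈ X.cones, X.sections k ℳ σ →ₗ[X.chartRing k σ] X.sections k 𝒩 σ
  naturality : ∀ σ (hσ : σ ∈ X.cones) τ (hτ : τ ∈ X.cones) (h : τ ⊆ σ) (z : X.sections k ℳ σ),
    app τ hτ (X.sectionsRes k ℳ h z) = X.sectionsRes k 𝒩 h (app σ hσ z)

/-- The map induced on sections over `U_σ` by a degree zero homomorphism of graded modules. -/
noncomputable def sectionsMap (f : M →ₗ[X.Cox k] N) (hf : ∀ α, ∀ m ∈ ℳ α, f m ∈ 𝒩 α)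
    (σ : Finset R) : X.sections k ℳ σ →ₗ[X.chartRing k σ] X.sections k 𝒩 σ :=
  LinearMap.restrict
    ((LocalizedModule.map (X.coneSub k σ) f).restrictScalars (X.chartRing k σ)) (by
      rintro _ ⟨n, m, hm, rfl⟩
      exact ⟨n, f m, hf _ m hm, by simp [LocalizedModule.map_mk]⟩)

/-- The sheaf `M~` is not zero. -/
def SheafNeZero : Prop := ∃ σ ∈ X.cones, Nontrivial (X.sections k ℳ σ)

end Sheaf

/-! ### Virtual resolutions -/

/-- The grading of the free module `⨁ⱼ S(-aⱼ)`, whose `j`-th basis vector has degree `aⱼ`. -/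
noncomputable def freeGrading {b : ℕ} (a : Fin b → X.Pic) (α : X.Pic) :
    AddSubgroup (Fin b → X.Cox k) where
  carrier := {x | ∀ j, x j ∈ X.coxGrading k (α - a j)}
  zero_mem' _ := zero_mem _
  add_mem' hx hy j := add_mem (hx j) (hy j)
  neg_mem' hx j := neg_mem (hx j)

instance {b : ℕ} (a : Fin b → X.Pic) :
    SetLike.GradedSMul (X.coxGrading k) (X.freeGrading k a) where
  smul_mem {α β s x} hs hx j := by
    have := SetLike.mul_mem_graded hs (hx j)
    rwa [← add_sub_assoc] at this

/-- A complex `F₀ ← F₁ ← F₂ ← ⋯` of finitely generated `Pic(X)`-graded free `S`-modules, with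
`Fᵢ = ⨁ⱼ S(-aᵢⱼ)` and differentials of degree zero. -/
structure FreeComplex where
  rank : ℕ → ℕ
  twist : ∀ i, Fin (rank i) → X.Pic
  diff : ∀ i, (Fin (rank (i + 1)) → X.Cox k) →ₗ[X.Cox k] (Fin (rank i) → X.Cox k)
  diff_deg : ∀ i α, ∀ x ∈ X.freeGrading k (twist (i + 1)) α,
    diff i x ∈ X.freeGrading k (twist i) α
  diff_comp_diff : ∀ i, diff i ∘ₗ diff (i + 1) = 0

namespace FreeComplex

variable {X k}

/-- The grading of the `i`-th term of the complex. -/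
noncomputable abbrev grading (F : X.FreeComplex k) (i : ℕ) :
    X.Pic → AddSubgroup (Fin (F.rank i) → X.Cox k) := X.freeGrading k (F.twist i)

/-- The differential of the complex of sheaves `F~`, on the chart `U_σ`. -/
noncomputable def sheafDiff (F : X.FreeComplex k) (i : ℕ) (σ : Finset R) :
    X.sections k (F.grading (i + 1)) σ →ₗ[X.chartRing k σ] X.sections k (F.grading i) σ :=
  X.sectionsMap k _ _ (F.diff i) (F.diff_deg i) σ

/-- `F` is a virtual resolution of `M`: for some morphism of sheaves `ε : F₀~ → M~`, the
augmented complex of sheaves `0 ← M~ ← F₀~ ← F₁~ ← ⋯` is exact. -/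
def IsVirtualResolution (F : X.FreeComplex k)
    {M : Type*} [AddCommGroup M] [Module (X.Cox k) M] (ℳ : X.Pic → AddSubgroup M)
    [SetLike.GradedSMul (X.coxGrading k) ℳ] : Prop :=
  ∃ ε : X.SheafHom k (F.grading 0) ℳ, ∀ σ (hσ : σ ∈ X.cones),
    Function.Surjective (ε.app σ hσ) ∧
    Function.Exact (F.sheafDiff 0 σ) (ε.app σ hσ) ∧
    ∀ i, Function.Exact (F.sheafDiff (i + 1) σ) (F.sheafDiff i σ)

/-- `Fᵢ = 0` for all `i > n`. -/
def HasLengthLE (F : X.FreeComplex k) (n : ℕ) : Prop := ∀ i, n < i → F.rank i = 0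

end FreeComplex

section CohenMacaulay

variable {M : Type*} [AddCommGroup M] [Module (X.Cox k) M] (ℳ : X.Pic → AddSubgroup M)
  [SetLike.GradedSMul (X.coxGrading k) ℳ]

/-- The virtual dimension of `M`: the minimal length of a virtual resolution of `M`. -/
noncomputable def vdim : ℕ∞ :=
  sInf {l | ∃ (F : X.FreeComplex k) (n : ℕ), F.IsVirtualResolution ℳ ∧ F.HasLengthLE n ∧ l = n}

/-- The codimension of `M`, i.e. the codimension of `Spec (S / Ann M)` in `Spec S`. -/
noncomputable def codim (M : Type*) [AddCommGroup M] [Module (X.Cox k) M] : ℕ∞ :=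
  (Module.annihilator (X.Cox k) M).height

/-- `M` is arithmetically Cohen–Macaulay: it is a Cohen–Macaulay `S`-module. -/
def IsArithmeticallyCM (M : Type*) [AddCommGroup M] [Module (X.Cox k) M] : Prop :=
  IsCohenMacaulayModule (X.Cox k) M

/-- `M` is virtually Cohen–Macaulay: `M~ ≠ 0` and `vdim M = codim M`. -/
def IsVirtuallyCM : Prop := X.SheafNeZero k ℳ ∧ X.vdim k ℳ = X.codim k M

/-- An ideal is relevant if it contains no power `B^t`, `t ≥ 1`, of the irrelevant ideal. -/
def IsRelevant (I : Ideal (X.Cox k)) : Prop := ∀ t : ℕ, 1 ≤ t → ¬ X.irrelevantIdeal k ^ t ≤ I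

/-- `M` is geometrically Cohen–Macaulay: `M_P` is Cohen–Macaulay for all relevant primes `P` in
the support of `M`. -/
def IsGeometricallyCM (M : Type*) [AddCommGroup M] [Module (X.Cox k) M] : Prop :=
  ∀ P ∈ Module.support (X.Cox k) M, X.IsRelevant k P.asIdeal → IsCohenMacaulayAt (X.Cox k) M P

end CohenMacaulay

end SmoothProjectiveFan

/-
Outside the zero locus of `B`, a virtual resolution of `M` is an honest free resolution: at a
relevant prime `P` in the support of `M`, localizing it gives a free resolution of `M_P`, of the
same length `n`, over the regular local ring `S_P`. Depth drops by at most one at each step of such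
a resolution, so `depth M_P ≥ dim S_P - n`, while `depth M_P ≤ dim M_P ≤ dim S_P - codim M`. Hence
`codim M ≤ vdim M` as soon as such a prime exists, that is, if `M~ ≠ 0`; and if `vdim M = codim M`,
then `depth M_P = dim M_P`.

Conversely, the minimal graded free resolution of `M` is a virtual resolution. It remains minimal at
the origin `0` of `Spec S`, and depth counting there bounds its length by `dim S_0 - depth M_0`,
which for `M` Cohen–Macaulay is `dim S_0 - dim M_0 ≤ codim M`.
-/

universe u v

/-! ### Depth and free resolutions -/

section Depth

open IsLocalRing RingTheory.Sequence CategoryTheory CategoryTheory.Abelian Pointwise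

/-- The finite module `N` over the local ring `A` has depth at least `n`: it has a regular sequence
of length `n` in the maximal ideal. The zero module has depth at least `n` for all `n`. -/
def HasDepthGE (A : Type*) [CommRing A] [IsLocalRing A] (N : Type*) [AddCommGroup N] [Module A N]
    (n : ℕ) : Prop :=
  Subsingleton N ∨ ∃ rs : List A, rs.length = n ∧ (∀ r ∈ rs, r ∈ maximalIdeal A) ∧ IsRegular N rs

namespace HasDepthGE

section LocalRing

variable {A : Type*} [CommRing A] [IsLocalRing A] {n : ℕ}

lemma congr {N N' : Type*} [AddCommGroup N] [Module A N] [AddCommGroup N'] [Module A N']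
    (e : N ≃ₗ[A] N') (h : HasDepthGE A N n) : HasDepthGE A N' n := by
  rcases h with hN | ⟨rs, hlen, hmem, hreg⟩
  · exact .inl e.symm.toEquiv.subsingleton
  · exact .inr ⟨rs, hlen, hmem, (e.isRegular_congr rs).mp hreg⟩

lemma iff_exists_isRegular {N : Type*} [AddCommGroup N] [Module A N] [Nontrivial N] :
    HasDepthGE A N n ↔
      ∃ rs : List A, rs.length = n ∧ (∀ r ∈ rs, r ∈ maximalIdeal A) ∧ IsRegular N rs :=
  or_iff_right (not_subsingleton N)

lemma zero (N : Type*) [AddCommGroup N] [Module A N] : HasDepthGE A N 0 := by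
  rcases subsingleton_or_nontrivial N with hN | hN
  · exact .inl hN
  · exact .inr ⟨[], rfl, by simp, .nil A N⟩

lemma free (h : HasDepthGE A A n) (F : Type*) [AddCommGroup F] [Module A F]
    [Module.Finite A F] [Module.Free A F] : HasDepthGE A F n := by
  rcases subsingleton_or_nontrivial F with hF | hF
  · exact .inl hF
  obtain ⟨rs, hlen, hmem, hreg⟩ := iff_exists_isRegular.mp h
  refine .inr ⟨rs, hlen, hmem, .of_isWeaklyRegular_of_mem_maximalIdeal F hmem ?_⟩
  exact ((TensorProduct.rid A F).isWeaklyRegular_congr rs).mp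
    (hreg.toIsWeaklyRegular.isWeaklyRegular_lTensor (M₂ := F))

lemma of_quotSMulTop {N : Type*} [AddCommGroup N] [Module A N] [Module.Finite A N] {x : A}
    (hxm : x ∈ maximalIdeal A) (hx : IsSMulRegular N x) (h : HasDepthGE A (QuotSMulTop x N) n) :
    HasDepthGE A N (n + 1) := by
  rcases subsingleton_or_nontrivial N with hN | hN
  · exact .inl hN
  have := nontrivial_quotSMulTop_of_mem_maximalIdeal N hxm
  obtain ⟨rs, hlen, hmem, hreg⟩ := iff_exists_isRegular.mp h
  exact .inr ⟨x :: rs, by simpa using hlen, List.forall_mem_cons.mpr ⟨hxm, hmem⟩, .cons hx hreg⟩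

lemma iff_of_algebraMap_surjective {B : Type*} [CommRing B] [IsLocalRing B] [Algebra A B]
    (hAB : Function.Surjective (algebraMap A B)) {N : Type*} [AddCommGroup N] [Module A N]
    [Module B N] [IsScalarTower A B N] : HasDepthGE B N n ↔ HasDepthGE A N n := by
  have : IsLocalHom (algebraMap A B) := IsLocalHom.of_surjective _ hAB
  have isRegular_map (rs : List A) : IsRegular N (rs.map (algebraMap A B)) ↔ IsRegular N rs :=
    (AddEquiv.refl N).isRegular_congr <| List.forall₂_map_left_iff.mpr <|
      List.forall₂_same.mpr fun r _ => algebraMap_smul B r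
  refine or_congr_right ⟨?_, ?_⟩
  · rintro ⟨rs', hlen, hmem, hreg⟩
    obtain ⟨rs, rfl⟩ := List.map_surjective_iff.mpr hAB rs'
    refine ⟨rs, by simpa using hlen, fun r hr => ?_, (isRegular_map rs).mp hreg⟩
    rw [← maximalIdeal_comap (algebraMap A B)]
    exact hmem _ (List.mem_map_of_mem hr)
  · rintro ⟨rs, hlen, hmem, hreg⟩
    refine ⟨rs.map (algebraMap A B), by simpa using hlen, fun r hr => ?_,
      (isRegular_map rs).mpr hreg⟩
    obtain ⟨a, ha, rfl⟩ := List.mem_map.mp hr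
    exact map_maximalIdeal_le (algebraMap A B) (Ideal.mem_map_of_mem _ (hmem a ha))

end LocalRing

section Noetherian

variable {A : Type u} [CommRing A] [IsLocalRing A] [IsNoetherianRing A] {n : ℕ}

lemma le_supportDim {N : Type*} [AddCommGroup N] [Module A N] [Module.Finite A N] [Nontrivial N]
    (h : HasDepthGE A N n) : (n : WithBot ℕ∞) ≤ Module.supportDim A N := by
  obtain ⟨rs, rfl, -, hreg⟩ := iff_exists_isRegular.mp h
  rw [← Module.supportDim_add_length_eq_supportDim_of_isRegular rs hreg]
  have := hreg.quot_ofList_smul_nontrivial ⊤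
  have : Nonempty (Module.support A (N ⧸ Ideal.ofList rs • (⊤ : Submodule A N))) :=
    Module.nonempty_support_of_nontrivial.to_subtype
  exact le_add_of_nonneg_left Order.krullDim_nonneg

end Noetherian

section Ext

variable {A : Type u} [CommRing A] [IsLocalRing A] [IsNoetherianRing A] [Small.{v} A] {n : ℕ}

lemma iff_subsingleton_ext (N : Type v) [AddCommGroup N] [Module A N] [Module.Finite A N] :
    HasDepthGE A N n ↔ ∀ i < n, Subsingleton
      (Ext (ModuleCat.of A (Shrink.{v} (A ⧸ maximalIdeal A))) (ModuleCat.of A N) i) := by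
  rcases subsingleton_or_nontrivial N with hN | hN
  · have hzero : Limits.IsZero (ModuleCat.of A N) := ModuleCat.isZero_of_subsingleton _
    refine iff_of_true (.inl hN) fun i _ => subsingleton_of_forall_eq 0 fun a => ?_
    rw [← a.comp_mk₀_id, hzero.eq_of_src (𝟙 _) 0, Ext.mk₀_zero, Ext.comp_zero]
  · have hlt : maximalIdeal A • (⊤ : Submodule A N) < ⊤ :=
      lt_top_iff_ne_top.mpr (Submodule.top_ne_ideal_smul_of_le_jacobson_annihilator
        (maximalIdeal_le_jacobson _)).symm
    exact iff_exists_isRegular.trans <|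
      (ModuleCat.exists_isRegular_tfae (maximalIdeal A) n (ModuleCat.of A N) hlt).out 3 1

lemma mono {N : Type v} [AddCommGroup N] [Module A N] [Module.Finite A N] {m : ℕ}
    (h : HasDepthGE A N n) (hmn : m ≤ n) : HasDepthGE A N m :=
  (iff_subsingleton_ext N).mpr fun i hi =>
    (iff_subsingleton_ext N).mp h i (hi.trans_le hmn)

variable {K F N : Type v} [AddCommGroup K] [Module A K] [Module.Finite A K]
  [AddCommGroup F] [Module A F] [Module.Finite A F] [AddCommGroup N] [Module A N]
  [Module.Finite A N] {f : K →ₗ[A] F} {g : F →ₗ[A] N}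

lemma of_exact_right (hf : Function.Injective f) (hg : Function.Surjective g)
    (hfg : Function.Exact f g) (hF : HasDepthGE A F n) (hK : HasDepthGE A K (n + 1)) :
    HasDepthGE A N n := by
  rw [iff_subsingleton_ext] at *
  have S := ModuleCat.shortComplex_shortExact
    (.mk (ModuleCat.ofHom f) (ModuleCat.ofHom g) (ModuleCat.hom_ext hfg.linearMap_comp_eq_zero))
    hfg hf hg
  intro i hi
  have := hF i hi
  have := hK (i + 1) (by lia)
  refine subsingleton_of_forall_eq 0 fun x => ?_
  obtain ⟨y, rfl⟩ := Ext.covariant_sequence_exact₃ _ S x (n₁ := i + 1) rfl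
    (Subsingleton.elim (α := Ext _ (ModuleCat.of A K) (i + 1)) _ _)
  rw [Subsingleton.elim (α := Ext _ (ModuleCat.of A F) i) y 0, Ext.zero_comp]

lemma of_exact_left (hf : Function.Injective f) (hg : Function.Surjective g)
    (hfg : Function.Exact f g) (hF : HasDepthGE A F (n + 1)) (hN : HasDepthGE A N n) :
    HasDepthGE A K (n + 1) := by
  rw [iff_subsingleton_ext] at *
  have S := ModuleCat.shortComplex_shortExact
    (.mk (ModuleCat.ofHom f) (ModuleCat.ofHom g) (ModuleCat.hom_ext hfg.linearMap_comp_eq_zero))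
    hfg hf hg
  intro i hi
  have := hF i hi
  refine subsingleton_of_forall_eq 0 fun x => ?_
  cases i with
  | zero =>
    have := S.mono_f
    apply Ext.postcomp_mk₀_injective_of_mono _ (ModuleCat.ofHom f)
    exact Subsingleton.elim (α := Ext _ (ModuleCat.of A F) 0) _ _
  | succ i =>
    have := hN i (by lia)
    obtain ⟨y, rfl⟩ := Ext.covariant_sequence_exact₁ _ S x
      (Subsingleton.elim (α := Ext _ (ModuleCat.of A F) (i + 1)) _ _) (n₀ := i) rfl
    rw [Subsingleton.elim (α := Ext _ (ModuleCat.of A N) i) y 0, Ext.zero_comp]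

lemma quotSMulTop {x : A} (hx : IsSMulRegular N x) (h : HasDepthGE A N (n + 1)) :
    HasDepthGE A (QuotSMulTop x N) n :=
  of_exact_right (f := LinearMap.lsmul A N x) (g := (x • (⊤ : Submodule A N)).mkQ) hx
    (Submodule.mkQ_surjective _) (LinearMap.exact_lsmul_mkQ_smul_top N x) (h.mono n.le_succ) h

theorem quotient_range_of_resolution {r : ℕ} (hA : HasDepthGE A A r)
    (F : ℕ → Type v) [∀ i, AddCommGroup (F i)] [∀ i, Module A (F i)] [∀ i, Module.Finite A (F i)]
    [∀ i, Module.Free A (F i)] (f : ∀ i, F (i + 1) →ₗ[A] F i)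
    (hf : ∀ i, Function.Exact (f (i + 1)) (f i)) (hF : ∀ i, n < i → Subsingleton (F i)) :
    HasDepthGE A (F 0 ⧸ LinearMap.range (f 0)) (r - n) := by
  induction n generalizing F with
  | zero =>
    have := hF 1 Nat.one_pos
    have hrange : LinearMap.range (f 0) = ⊥ := by
      rw [Subsingleton.elim (f 0) 0, LinearMap.range_zero]
    exact (hA.free (F 0)).congr (Submodule.quotEquivOfEqBot _ hrange).symm
  | succ n ih =>
    rcases Nat.lt_or_ge n r with hr | hr
    swap
    · rw [Nat.sub_eq_zero_of_le (hr.trans n.le_succ)]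
      exact zero _
    have hrange : HasDepthGE A (LinearMap.range (f 0)) (r - n) :=
      (ih (fun i => F (i + 1)) (fun i => f (i + 1)) (fun i => hf (i + 1))
        fun i hi => hF (i + 1) (by lia)).congr <|
          (Submodule.quotEquivOfEq _ _ (hf 0).linearMap_ker_eq.symm).trans (f 0).quotKerEquivRange
    rw [show r - n = r - (n + 1) + 1 by lia] at hrange
    exact of_exact_right (LinearMap.range (f 0)).subtype_injective (Submodule.mkQ_surjective _)
      (LinearMap.exact_subtype_mkQ _) ((hA.mono (Nat.sub_le _ _)).free (F 0)) hrange

end Ext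

end HasDepthGE

end Depth

/-! ### Regular local rings -/

section RegularLocalRing

open IsLocalRing RingTheory.Sequence Pointwise

lemma exists_mem_notMem_of_not_le {A : Type*} [CommRing A] {I J : Ideal A} (hJ : ¬ I ≤ J)
    {s : Set (Ideal A)} (hs : s.Finite) (hprime : ∀ Q ∈ s, Q.IsPrime) (hle : ∀ Q ∈ s, ¬ I ≤ Q) :
    ∃ x ∈ I, x ∉ J ∧ ∀ Q ∈ s, x ∉ Q := by
  by_contra! H
  have hcover : (I : Set A) ⊆ ⋃ Q ∈ insert J s, (Q : Set A) := fun x hx => by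
    by_cases hxJ : x ∈ J
    · exact Set.mem_biUnion (Set.mem_insert J s) hxJ
    · obtain ⟨Q, hQ, hxQ⟩ := H x hx hxJ
      exact Set.mem_biUnion (Set.mem_insert_of_mem J hQ) hxQ
  obtain ⟨Q, rfl | hQ, hIQ⟩ := (Ideal.subset_union_prime_finite (hs.insert J) (f := id) J J
    fun Q hQ hQJ _ => hprime Q (hQ.resolve_left hQJ)).mp hcover
  exacts [hJ hIQ, hle Q hQ hIQ]

lemma isSMulRegular_iff_forall_associatedPrimes {A : Type*} [CommRing A] [IsNoetherianRing A]
    {N : Type*} [AddCommGroup N] [Module A N] {x : A} :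
    IsSMulRegular N x ↔ ∀ Q ∈ associatedPrimes A N, x ∉ Q := by
  have h := Set.ext_iff.mp (biUnion_associatedPrimes_eq_compl_regular A N) x
  simp only [Set.mem_iUnion, SetLike.mem_coe, Set.mem_compl_iff, Set.mem_ofPred_eq] at h
  rw [← not_iff_not, ← h]
  simp

variable {A : Type*} [CommRing A]

lemma isLocalRing_quotient_span_singleton [IsLocalRing A] {x : A} (hx : x ∈ maximalIdeal A) :
    IsLocalRing (A ⧸ Ideal.span {x}) := by
  have : Nontrivial (A ⧸ Ideal.span {x}) := Ideal.Quotient.nontrivial_iff.mpr <|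
    mt Ideal.span_singleton_eq_top.mp ((mem_maximalIdeal x).mp hx)
  exact .of_surjective' _ Ideal.Quotient.mk_surjective

lemma exists_maximalIdeal_eq_span_insert_erase [IsLocalRing A] [DecidableEq A] {s : Finset A}
    (hs : Ideal.span (s : Set A) = maximalIdeal A) {x : A} (hx : x ∈ maximalIdeal A)
    (hx2 : x ∉ maximalIdeal A ^ 2) :
    ∃ a ∈ s, maximalIdeal A = Ideal.span (insert x (s.erase a : Set A)) := by
  have hsub : (s : Set A) ⊆ maximalIdeal A := hs ▸ Ideal.subset_span
  obtain ⟨c, -, hc⟩ := Submodule.mem_span_finset.mp (hs ▸ hx)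
  obtain ⟨a, ha, hca⟩ : ∃ a ∈ s, IsUnit (c a) := by
    by_contra! H
    refine hx2 (hc ▸ sq (maximalIdeal A) ▸ Ideal.sum_mem _ fun a ha => ?_)
    exact Ideal.mul_mem_mul ((mem_maximalIdeal _).mpr (H a ha)) (hsub ha)
  refine ⟨a, ha, le_antisymm (hs.ge.trans (Ideal.span_le.mpr fun b hb => ?_)) ?_⟩
  · by_cases hba : b = a
    · subst hba
      rw [SetLike.mem_coe, ← Ideal.unit_mul_mem_iff_mem _ hca, ← smul_eq_mul,
        eq_sub_of_add_eq ((Finset.add_sum_erase s _ ha).trans hc)]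
      refine sub_mem (Ideal.subset_span (Set.mem_insert x _)) (Ideal.sum_mem _ fun j hj => ?_)
      exact Ideal.mul_mem_left _ _ (Ideal.subset_span (Set.mem_insert_of_mem x hj))
    · exact Ideal.subset_span (Set.mem_insert_of_mem x (Finset.mem_erase.mpr ⟨hba, hb⟩))
  · exact Ideal.span_le.mpr (Set.insert_subset hx fun b hb => hsub (Finset.mem_of_mem_erase hb))

lemma spanFinrank_maximalIdeal_quotient_add_one_le [IsLocalRing A] [IsNoetherianRing A] {x : A}
    (hx : x ∈ maximalIdeal A) (hx2 : x ∉ maximalIdeal A ^ 2)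
    [IsLocalRing (A ⧸ Ideal.span {x})] :
    (maximalIdeal (A ⧸ Ideal.span {x})).spanFinrank + 1 ≤ (maximalIdeal A).spanFinrank := by
  classical
  have hfg : Submodule.FG (maximalIdeal A) := IsNoetherian.noetherian _
  obtain ⟨s, hs⟩ := hfg.finite_generators.exists_finset_coe
  obtain ⟨a, ha, hspan⟩ := exists_maximalIdeal_eq_span_insert_erase (s := s)
    (hs ▸ Submodule.span_generators _) hx hx2
  have hmax : maximalIdeal (A ⧸ Ideal.span {x}) =
      Ideal.span (Ideal.Quotient.mk (Ideal.span {x}) '' (s.erase a : Set A)) := by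
    rw [← map_maximalIdeal_of_surjective _ Ideal.Quotient.mk_surjective, hspan, Ideal.map_span,
      Set.image_insert_eq, Ideal.Quotient.eq_zero_iff_mem.mpr (Ideal.mem_span_singleton_self x)]
    exact Submodule.span_insert_zero
  calc
    _ ≤ (Ideal.Quotient.mk (Ideal.span {x}) '' (s.erase a : Set A)).ncard + 1 := by
      rw [hmax]
      gcongr
      exact Submodule.spanFinrank_span_le_ncard_of_finite ((Finset.finite_toSet _).image _)
    _ ≤ (s.erase a).card + 1 := by
      gcongr
      exact (Set.ncard_image_le (Finset.finite_toSet _)).trans_eq (Set.ncard_coe_finset _)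
    _ = (maximalIdeal A).spanFinrank := by
      rw [Finset.card_erase_add_one ha, ← hfg.generators_ncard, ← hs, Set.ncard_coe_finset]

section

variable [IsRegularLocalRing A] {x : A}

lemma isRegularLocalRing_quotient_span_singleton (hx : x ∈ maximalIdeal A)
    (hx2 : x ∉ maximalIdeal A ^ 2) : IsRegularLocalRing (A ⧸ Ideal.span {x}) := by
  have := isLocalRing_quotient_span_singleton hx
  refine .of_spanFinrank_maximalIdeal_le _ ?_
  have hle := spanFinrank_maximalIdeal_quotient_add_one_le hx hx2
  have hdim : ((maximalIdeal A).spanFinrank : WithBot ℕ∞) ≤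
      ringKrullDim (A ⧸ Ideal.span {x}) + 1 := by
    rw [IsRegularLocalRing.spanFinrank_maximalIdeal, ← maximalIdeal_height_eq_ringKrullDim]
    exact Ideal.height_le_ringKrullDim_quotient_add_one hx
  exact ENat.WithBot.add_le_add_one_right_iff.mp (le_trans (by exact_mod_cast hle) hdim)

lemma spanFinrank_maximalIdeal_quotient_add_one [IsRegularLocalRing (A ⧸ Ideal.span {x})]
    (hx : x ∈ maximalIdeal A) (hx2 : x ∉ maximalIdeal A ^ 2) :
    (maximalIdeal (A ⧸ Ideal.span {x})).spanFinrank + 1 = (maximalIdeal A).spanFinrank := by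
  refine le_antisymm (spanFinrank_maximalIdeal_quotient_add_one_le hx hx2) ?_
  have hdim : ((maximalIdeal A).spanFinrank : WithBot ℕ∞) ≤
      (maximalIdeal (A ⧸ Ideal.span {x})).spanFinrank + 1 := by
    rw [IsRegularLocalRing.spanFinrank_maximalIdeal, IsRegularLocalRing.spanFinrank_maximalIdeal,
      ← maximalIdeal_height_eq_ringKrullDim]
    exact Ideal.height_le_ringKrullDim_quotient_add_one hx
  exact_mod_cast hdim

end

lemma maximalIdeal_ne_bot_of_spanFinrank_ne_zero [IsLocalRing A]
    (h : (maximalIdeal A).spanFinrank ≠ 0) : maximalIdeal A ≠ ⊥ := by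
  rintro h0
  rw [h0] at h
  exact h Submodule.spanFinrank_bot

lemma not_maximalIdeal_le_sq [IsLocalRing A] [IsNoetherianRing A] (h : maximalIdeal A ≠ ⊥) :
    ¬ maximalIdeal A ≤ maximalIdeal A ^ 2 := fun hle => by
  have hidem : IsIdempotentElem (maximalIdeal A) := by
    rw [IsIdempotentElem, ← sq]
    exact (Ideal.pow_le_self two_ne_zero).antisymm hle
  rcases (Ideal.isIdempotentElem_iff_eq_bot_or_top_of_isLocalRing _).mp hidem with h0 | h1
  exacts [h h0, Ideal.IsPrime.ne_top' h1]

lemma isDomain_of_isPrime_span_singleton [IsLocalRing A] [IsNoetherianRing A] {x : A}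
    (hx : x ∈ maximalIdeal A) (hmin : ∀ Q ∈ minimalPrimes A, x ∉ Q)
    (hprime : (Ideal.span {x}).IsPrime) : IsDomain A := by
  obtain ⟨Q, hQ, hQx⟩ := Ideal.exists_minimalPrimes_le (bot_le (a := Ideal.span {x}))
  have hQp : Q.IsPrime := hQ.isPrime
  have hQ0 : Q = ⊥ := by
    refine Submodule.eq_bot_of_le_smul_of_le_jacobson_bot (Ideal.span {x}) Q
      (IsNoetherian.noetherian Q) (fun y hy => ?_) ?_
    · obtain ⟨a, rfl⟩ := Ideal.mem_span_singleton'.mp (hQx hy)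
      rw [smul_eq_mul, mul_comm a x]
      exact Ideal.mul_mem_mul (Ideal.mem_span_singleton_self x)
        ((hQp.mem_or_mem hy).resolve_right (hmin Q hQ))
    · rw [Ideal.span_singleton_le_iff_mem]
      exact maximalIdeal_le_jacobson _ hx
  subst hQ0
  exact IsDomain.of_bot_isPrime A

theorem isDomain_of_isRegularLocalRing (A : Type*) [CommRing A] [IsRegularLocalRing A] :
    IsDomain A := by
  induction hn : (maximalIdeal A).spanFinrank generalizing A with
  | zero =>
    rw [Submodule.spanFinrank_eq_zero_iff_eq_bot (IsNoetherian.noetherian _)] at hn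
    exact (isField_iff_maximalIdeal_eq.mpr hn).isDomain
  | succ n ih =>
    have hne := maximalIdeal_ne_bot_of_spanFinrank_ne_zero (A := A) (by lia)
    have hnotmin : ∀ Q ∈ minimalPrimes A, ¬ maximalIdeal A ≤ Q := fun Q hQ hle => by
      have hQp : Q.IsPrime := hQ.isPrime
      have hheight : (maximalIdeal A).height = 0 := by
        rw [hle.antisymm (le_maximalIdeal hQp.ne_top), Ideal.height_eq_zero_iff]
        exact hQ
      have hdim := IsRegularLocalRing.spanFinrank_maximalIdeal (R := A)
      rw [hn, ← maximalIdeal_height_eq_ringKrullDim, hheight] at hdim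
      exact n.succ_ne_zero (by exact_mod_cast hdim)
    obtain ⟨x, hx, hx2, hmin⟩ := exists_mem_notMem_of_not_le (not_maximalIdeal_le_sq hne)
      (minimalPrimes.finite_of_isNoetherianRing A)
      (fun Q hQ => hQ.isPrime) hnotmin
    have := isRegularLocalRing_quotient_span_singleton hx hx2
    have := ih (A ⧸ Ideal.span {x})
      (by have := spanFinrank_maximalIdeal_quotient_add_one hx hx2; lia)
    exact isDomain_of_isPrime_span_singleton hx hmin
      ((Ideal.Quotient.isDomain_iff_prime _).mp this)

/-- `A ⧸ xA`, as the quotient of the module `A` by `x` and as the quotient ring. -/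
def quotSMulTopSelfEquiv (x : A) : QuotSMulTop x A ≃ₗ[A] A ⧸ Ideal.span {x} :=
  Submodule.quotEquivOfEq _ _ <| by
    rw [← Submodule.ideal_span_singleton_smul, smul_eq_mul, Ideal.mul_top]

theorem HasDepthGE.of_isRegularLocalRing (A : Type*) [CommRing A] [IsRegularLocalRing A] :
    HasDepthGE A A (maximalIdeal A).spanFinrank := by
  induction hn : (maximalIdeal A).spanFinrank generalizing A with
  | zero => exact zero A
  | succ n ih =>
    have hne := maximalIdeal_ne_bot_of_spanFinrank_ne_zero (A := A) (by lia)
    obtain ⟨x, hx, hx2⟩ := SetLike.not_le_iff_exists.mp (not_maximalIdeal_le_sq hne)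
    have := isRegularLocalRing_quotient_span_singleton hx hx2
    have hquot := ih (A ⧸ Ideal.span {x})
      (by have := spanFinrank_maximalIdeal_quotient_add_one hx hx2; lia)
    rw [iff_of_algebraMap_surjective (A := A) Ideal.Quotient.mk_surjective] at hquot
    have := isDomain_of_isRegularLocalRing A
    have hreg : IsSMulRegular A x := IsSMulRegular.of_ne_zero fun h => hx2 (h ▸ zero_mem _)
    exact (hquot.congr (quotSMulTopSelfEquiv x).symm).of_quotSMulTop hx hreg

theorem HasDepthGE.free_of_isRegularLocalRing {A : Type u} [CommRing A] [Small.{v} A]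
    [IsRegularLocalRing A] {N : Type v} [AddCommGroup N] [Module A N] [Module.Finite A N]
    (h : HasDepthGE A N (maximalIdeal A).spanFinrank) : Module.Free A N := by
  induction hn : (maximalIdeal A).spanFinrank generalizing A N with
  | zero =>
    rw [Submodule.spanFinrank_eq_zero_iff_eq_bot (IsNoetherian.noetherian _)] at hn
    let := (isField_iff_maximalIdeal_eq.mpr hn).toField
    infer_instance
  | succ n ih =>
    rcases subsingleton_or_nontrivial N with hN | hN
    · infer_instance
    rw [hn] at h
    obtain ⟨rs, hlen, hmem, hreg⟩ := iff_exists_isRegular.mp h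
    obtain ⟨r, rs, rfl⟩ := List.exists_cons_of_length_eq_add_one hlen
    have hr : IsSMulRegular N r := ((isRegular_cons_iff N r rs).mp hreg).1
    have hne := maximalIdeal_ne_bot_of_spanFinrank_ne_zero (A := A) (by lia)
    obtain ⟨x, hx, hx2, hxN⟩ := exists_mem_notMem_of_not_le (not_maximalIdeal_le_sq hne)
      (associatedPrimes.finite A N) (fun Q hQ => hQ.isPrime) fun Q hQ hle =>
        isSMulRegular_iff_forall_associatedPrimes.mp hr Q hQ (hle (hmem r List.mem_cons_self))
    rw [← isSMulRegular_iff_forall_associatedPrimes] at hxN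
    have := isRegularLocalRing_quotient_span_singleton hx hx2
    have : Small.{v} (A ⧸ Ideal.span {x}) := small_of_surjective Ideal.Quotient.mk_surjective
    have : Module.Finite (A ⧸ Ideal.span {x}) (QuotSMulTop x N) :=
      .of_restrictScalars_finite A _ _
    have hfin := spanFinrank_maximalIdeal_quotient_add_one hx hx2
    have hdim : (maximalIdeal (A ⧸ Ideal.span {x})).spanFinrank = n := by lia
    have hfree : Module.Free (A ⧸ Ideal.span {x}) (QuotSMulTop x N) := by
      refine ih ?_ hdim
      rw [hdim, iff_of_algebraMap_surjective (A := A) Ideal.Quotient.mk_surjective]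
      exact h.quotSMulTop hxN
    have := Module.finitePresentation_of_finite A N
    exact (Module.free_quotSMulTop_iff_free A N (maximalIdeal_le_jacobson _ hx) hxN).mp hfree

end RegularLocalRing

section AssociatedPrime

open IsLocalRing RingTheory.Sequence Pointwise

lemma height_add_height_le_height_comap {A : Type*} [CommRing A] (I : Ideal A) (J : Ideal (A ⧸ I))
    [J.IsPrime] : I.height + J.height ≤ (J.comap (Ideal.Quotient.mk I)).height := by
  have key (n : ℕ) (hn : n ≤ J.height) :
      I.height + n ≤ (J.comap (Ideal.Quotient.mk I)).height := by
    induction n generalizing J with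
    | zero =>
      rw [Nat.cast_zero, add_zero]
      exact Ideal.height_mono fun a ha => by
        rw [Ideal.mem_comap, Ideal.Quotient.eq_zero_iff_mem.mpr ha]
        exact J.zero_mem
    | succ n ih =>
      obtain ⟨Q, hQ, hQJ, hnQ⟩ : ∃ Q : Ideal (A ⧸ I), Q.IsPrime ∧ Q < J ∧ n ≤ Q.height := by
        by_contra! H
        exact (ENat.natCast_add_one_le_iff.mp (by exact_mod_cast hn)).not_ge
          (Ideal.height_le_iff.mpr H)
      have hlt : Q.comap (Ideal.Quotient.mk I) < J.comap (Ideal.Quotient.mk I) :=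
        (Ideal.orderEmbeddingOfSurjective _ Ideal.Quotient.mk_surjective).strictMono hQJ
      calc
        I.height + (n + 1 : ℕ) = I.height + n + 1 := by rw [Nat.cast_succ, add_assoc]
        _ ≤ (Q.comap (Ideal.Quotient.mk I)).height + 1 := by gcongr; exact ih Q hnQ
        _ ≤ _ := Ideal.height_add_one_le_of_lt_of_isPrime hlt
  cases h : J.height with
  | top =>
    rw [add_top, top_le_iff, ENat.eq_top_iff_forall_ge]
    exact fun n => le_add_self.trans (key n (h ▸ le_top))
  | coe n => exact key n h.ge

lemma isPrime_map_quotient_span_singleton {A : Type*} [CommRing A] {P : Ideal A} [P.IsPrime]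
    {x : A} (hxP : x ∈ P) : (P.map (Ideal.Quotient.mk (Ideal.span {x}))).IsPrime :=
  Ideal.map_isPrime_of_surjective Ideal.Quotient.mk_surjective <| by
    rwa [Ideal.mk_ker, Ideal.span_singleton_le_iff_mem]

lemma height_map_quotient_span_singleton_add_one_le {A : Type*} [CommRing A] {P : Ideal A}
    [P.IsPrime] {x : A} (hxP : x ∈ P) (hx : x ∈ nonZeroDivisors A) :
    (P.map (Ideal.Quotient.mk (Ideal.span {x}))).height + 1 ≤ P.height := by
  have hle : Ideal.span {x} ≤ P := (Ideal.span_singleton_le_iff_mem P).mpr hxP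
  have := isPrime_map_quotient_span_singleton hxP
  calc
    _ ≤ (P.map (Ideal.Quotient.mk (Ideal.span {x}))).height + (Ideal.span {x}).height := by
      gcongr
      exact Ideal.one_le_height_span_singleton_of_mem_nonZeroDivisors hx
    _ ≤ P.height := by
      rw [add_comm]
      exact (height_add_height_le_height_comap _ _).trans_eq (by rw [Ideal.comap_map_mk hle])

lemma height_map_add_ringKrullDim_quotient_map_add_one_le {A : Type*} [CommRing A] {P : Ideal A}
    [P.IsPrime] {x : A} (hxP : x ∈ P) (hx : x ∈ nonZeroDivisors A) :
    ((P.map (Ideal.Quotient.mk (Ideal.span {x}))).height : WithBot ℕ∞) + ringKrullDim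
        ((A ⧸ Ideal.span {x}) ⧸ P.map (Ideal.Quotient.mk (Ideal.span {x}))) + 1 ≤
      P.height + ringKrullDim (A ⧸ P) := by
  rw [ringKrullDim_eq_of_ringEquiv (DoubleQuot.quotQuotEquivQuotOfLE
    ((Ideal.span_singleton_le_iff_mem P).mpr hxP)), add_right_comm]
  gcongr
  exact WithBot.coe_le_coe.mpr (height_map_quotient_span_singleton_add_one_le hxP hx)

lemma height_add_ringKrullDim_quotient_le {A : Type*} [CommRing A] (I : Ideal A) :
    (I.height : WithBot ℕ∞) + ringKrullDim (A ⧸ I) ≤ ringKrullDim A := by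
  rcases subsingleton_or_nontrivial (A ⧸ I) with hI | hI
  · rw [ringKrullDim_eq_bot_of_subsingleton, WithBot.add_bot]
    exact bot_le
  rw [ringKrullDim, Order.krullDim_eq_iSup_height_of_nonempty, ← WithBot.coe_add, ENat.add_iSup,
    WithBot.coe_iSup (OrderTop.bddAbove _)]
  refine iSup_le fun J => (WithBot.coe_le_coe.mpr ?_).trans
    (Ideal.height_le_ringKrullDim_of_isPrime (I := J.asIdeal.comap (Ideal.Quotient.mk I)))
  rw [← PrimeSpectrum.height_eq_orderHeight]
  exact height_add_height_le_height_comap I J.asIdeal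

variable {A : Type*} [CommRing A] [IsNoetherianRing A]
  {N : Type*} [AddCommGroup N] [Module A N] [Module.Finite A N]

lemma exists_mem_torsionBySet_notMem_smul_top [IsLocalRing A] {x : A} (hxm : x ∈ maximalIdeal A)
    (hx : IsSMulRegular N x) {Q : Ideal A} (hQ : Q ∈ associatedPrimes A N) :
    ∃ u ∈ Submodule.torsionBySet A N Q, u ∉ x • (⊤ : Submodule A N) := by
  by_contra! hle
  have hbot : Submodule.torsionBySet A N Q = ⊥ := by
    refine Submodule.eq_bot_of_le_smul_of_le_jacobson_bot (Ideal.span {x}) _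
      (IsNoetherian.noetherian _) (fun u hu => ?_) ?_
    · obtain ⟨v, -, rfl⟩ := (Submodule.mem_smul_pointwise_iff_exists _ _ _).mp (hle u hu)
      rw [Submodule.ideal_span_singleton_smul]
      refine Submodule.smul_mem_pointwise_smul _ _ _ ?_
      rw [Submodule.mem_torsionBySet_iff] at hu ⊢
      exact fun a => hx.right_eq_zero_of_smul ((smul_comm x (a : A) v).trans (hu a))
    · rw [Ideal.span_singleton_le_iff_mem]
      exact maximalIdeal_le_jacobson _ hxm
  obtain ⟨-, y, rfl⟩ := isAssociatedPrime_iff.mp hQ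
  have hy : y ∈ Submodule.torsionBySet A N (Submodule.colon ⊥ {y} : Ideal A) := by
    simp
  rw [hbot, Submodule.mem_bot] at hy
  exact hQ.isPrime.ne_top (by simp [hy])

lemma exists_lt_mem_associatedPrimes_quotSMulTop [IsLocalRing A] {x : A}
    (hxm : x ∈ maximalIdeal A) (hx : IsSMulRegular N x) {Q : Ideal A}
    (hQ : Q ∈ associatedPrimes A N) : ∃ Q' ∈ associatedPrimes A (QuotSMulTop x N), Q < Q' := by
  obtain ⟨u, hu, hux⟩ := exists_mem_torsionBySet_notMem_smul_top hxm hx hQ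
  obtain ⟨Q', hQ', hle⟩ := exists_le_isAssociatedPrime_of_isNoetherianRing A
    (Submodule.Quotient.mk u : QuotSMulTop x N) (mt (Submodule.Quotient.mk_eq_zero _).mp hux)
  have mem_of_smul_mem (a : A) (ha : a • u ∈ x • (⊤ : Submodule A N)) : a ∈ Q' :=
    hle (Submodule.mem_colon_singleton.mpr ((Submodule.Quotient.mk_eq_zero _).mpr ha))
  refine ⟨Q', hQ', SetLike.lt_iff_le_and_exists.mpr ⟨fun a ha => mem_of_smul_mem a ?_, x,
    mem_of_smul_mem x (Submodule.smul_mem_pointwise_smul _ _ _ trivial),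
    isSMulRegular_iff_forall_associatedPrimes.mp hx Q hQ⟩⟩
  rw [(Submodule.mem_torsionBySet_iff _ _).mp hu ⟨a, ha⟩]
  exact zero_mem _

lemma ringKrullDim_quotient_add_one_le_of_lt {A : Type*} [CommRing A] {Q Q' : Ideal A}
    [Q.IsPrime] (h : Q < Q') : ringKrullDim (A ⧸ Q') + 1 ≤ ringKrullDim (A ⧸ Q) := by
  obtain ⟨a, ha, haQ⟩ := SetLike.exists_of_lt h
  refine ringKrullDim_succ_le_of_surjective (Ideal.Quotient.factor h.le)
    (Ideal.Quotient.factor_surjective h.le) (r := Ideal.Quotient.mk Q a) ?_ ?_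
  · rw [mem_nonZeroDivisors_iff_ne_zero, Ne, Ideal.Quotient.eq_zero_iff_mem]
    exact haQ
  · rwa [Ideal.Quotient.factor_mk, Ideal.Quotient.eq_zero_iff_mem]

lemma length_le_ringKrullDim_quotient_of_mem_associatedPrimes [IsLocalRing A] {rs : List A}
    (hrs : ∀ r ∈ rs, r ∈ maximalIdeal A) (hreg : IsWeaklyRegular N rs) {Q : Ideal A}
    (hQ : Q ∈ associatedPrimes A N) : (rs.length : WithBot ℕ∞) ≤ ringKrullDim (A ⧸ Q) := by
  have := hQ.isPrime
  induction rs generalizing N Q with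
  | nil => simpa using ringKrullDim_nonneg_of_nontrivial
  | cons x rs ih =>
    obtain ⟨hx, hreg⟩ := (isWeaklyRegular_cons_iff N x rs).mp hreg
    obtain ⟨hxm, hrs⟩ := List.forall_mem_cons.mp hrs
    obtain ⟨Q', hQ', hlt⟩ := exists_lt_mem_associatedPrimes_quotSMulTop hxm hx hQ
    calc
      ((x :: rs).length : WithBot ℕ∞) = rs.length + 1 := by simp
      _ ≤ ringKrullDim (A ⧸ Q') + 1 := by gcongr; exact ih hrs hreg hQ' hQ'.isPrime
      _ ≤ ringKrullDim (A ⧸ Q) := ringKrullDim_quotient_add_one_le_of_lt hlt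

theorem HasDepthGE.le_height_add_ringKrullDim_quotient {n : ℕ} {A : Type u} [CommRing A]
    [IsNoetherianRing A] [IsLocalRing A] (hA : HasDepthGE A A n) (P : Ideal A) [P.IsPrime] :
    (n : WithBot ℕ∞) ≤ P.height + ringKrullDim (A ⧸ P) := by
  induction n generalizing A with
  | zero =>
    exact add_nonneg (WithBot.coe_le_coe.mpr bot_le) ringKrullDim_nonneg_of_nontrivial
  | succ n ih =>
    obtain ⟨rs, hlen, hmem, hreg⟩ := iff_exists_isRegular.mp hA
    by_cases hP : ∃ Q ∈ associatedPrimes A A, P ≤ Q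
    · obtain ⟨Q, hQ, hPQ⟩ := hP
      refine le_add_of_nonneg_of_le (WithBot.coe_le_coe.mpr bot_le) ?_
      rw [← hlen]
      exact (length_le_ringKrullDim_quotient_of_mem_associatedPrimes hmem
        hreg.toIsWeaklyRegular hQ).trans (ringKrullDim_le_of_surjective
          (Ideal.Quotient.factor hPQ) (Ideal.Quotient.factor_surjective hPQ))
    push Not at hP
    obtain ⟨Q, hQ⟩ := associatedPrimes.nonempty A A
    obtain ⟨x, hxP, -, hx⟩ := exists_mem_notMem_of_not_le (hP Q hQ)
      (associatedPrimes.finite A A) (fun Q hQ => hQ.isPrime) hP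
    rw [← isSMulRegular_iff_forall_associatedPrimes] at hx
    have hxm : x ∈ maximalIdeal A := le_maximalIdeal (Ideal.IsPrime.ne_top ‹_›) hxP
    have := isLocalRing_quotient_span_singleton hxm
    have hquot : HasDepthGE (A ⧸ Ideal.span {x}) (A ⧸ Ideal.span {x}) n :=
      (iff_of_algebraMap_surjective (A := A) Ideal.Quotient.mk_surjective).mpr
        ((hA.quotSMulTop hx).congr (quotSMulTopSelfEquiv x))
    have : (P.map (Ideal.Quotient.mk (Ideal.span {x}))).IsPrime :=
      isPrime_map_quotient_span_singleton hxP
    rw [Nat.cast_succ]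
    exact (add_le_add_left (ih hquot _) 1).trans
      (height_map_add_ringKrullDim_quotient_map_add_one_le hxP
        (isLeftRegular_iff_isRegular.mp hx).mem_nonZeroDivisors)

end AssociatedPrime

/-! ### Graded modules over the Cox ring -/

open DirectSum in
lemma decompose_map_of_injective {ι κ M N F : Type*} [DecidableEq ι] [DecidableEq κ]
    [AddCommGroup M] [AddCommGroup N] [FunLike F M N] [AddMonoidHomClass F M N]
    (ℳ : ι → AddSubgroup M) [Decomposition ℳ] (𝒩 : κ → AddSubgroup N) [Decomposition 𝒩]
    (f : F) {φ : ι → κ} (hφ : φ.Injective) (hf : ∀ i, ∀ m ∈ ℳ i, f m ∈ 𝒩 (φ i)) (x : M) (i : ι) :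
    (decompose 𝒩 (f x) (φ i) : N) = f (decompose ℳ x i) := by
  induction x using Decomposition.inductionOn ℳ with
  | zero => simp
  | @homogeneous j m =>
    by_cases hji : j = i
    · subst hji
      rw [decompose_of_mem_same 𝒩 (hf _ _ m.2), decompose_of_mem_same ℳ m.2]
    · rw [decompose_of_mem_ne 𝒩 (hf _ _ m.2) (hφ.ne hji), decompose_of_mem_ne ℳ m.2 hji, map_zero]
  | add m m' h h' => simp [decompose_add, h, h']

open DirectSum in
lemma map_decompose_eq_zero_of_injective {ι κ M N F : Type*} [DecidableEq ι] [DecidableEq κ]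
    [AddCommGroup M] [AddCommGroup N] [FunLike F M N] [AddMonoidHomClass F M N]
    (ℳ : ι → AddSubgroup M) [Decomposition ℳ] (𝒩 : κ → AddSubgroup N) [Decomposition 𝒩]
    {f : F} {φ : ι → κ} (hφ : φ.Injective) (hf : ∀ i, ∀ m ∈ ℳ i, f m ∈ 𝒩 (φ i)) {x : M}
    (hx : f x = 0) (i : ι) : f (decompose ℳ x i) = 0 := by
  rw [← decompose_map_of_injective ℳ 𝒩 f hφ hf, hx, decompose_zero, DirectSum.zero_apply,
    AddSubgroup.coe_zero]

open DirectSum in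
lemma exists_mem_apply_eq {ι M N F : Type*} [DecidableEq ι] [AddCommGroup M] [AddCommGroup N]
    [FunLike F M N] [AddMonoidHomClass F M N] (ℳ : ι → AddSubgroup M) [Decomposition ℳ]
    (𝒩 : ι → AddSubgroup N) [Decomposition 𝒩] {f : F} (hf : ∀ i, ∀ m ∈ ℳ i, f m ∈ 𝒩 i) {y : N}
    {i : ι} (hy : y ∈ 𝒩 i) (hrange : y ∈ Set.range f) : ∃ x ∈ ℳ i, f x = y := by
  obtain ⟨x, rfl⟩ := hrange
  refine ⟨decompose ℳ x i, SetLike.coe_mem _, ?_⟩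
  rw [← decompose_map_of_injective ℳ 𝒩 f Function.injective_id hf]
  exact decompose_of_mem_same 𝒩 hy

namespace SmoothProjectiveFan

variable {d : ℕ} {R : Type*} [Fintype R] [DecidableEq R] (X : SmoothProjectiveFan d R)
  (k : Type*) [Field k]

section Weight

/- The cone containing `-∑ ray ρ` expresses this vector with nonnegative coefficients. -/
lemma exists_pos_sum_mul_ray_eq_zero :
    ∃ t : R → ℝ, (∀ ρ, 0 < t ρ) ∧ ∀ i, ∑ ρ, t ρ * (X.ray ρ i : ℝ) = 0 := by
  obtain ⟨σ, -, c, hc, hu⟩ := X.complete (fun i => -∑ ρ, (X.ray ρ i : ℝ))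
  refine ⟨fun ρ => 1 + if ρ ∈ σ then c ρ else 0, fun ρ => ?_, fun i => ?_⟩
  · have := hc ρ
    dsimp only
    split_ifs <;> linarith
  · have hi := congrFun hu i
    simp only [Finset.sum_apply, Pi.smul_apply, smul_eq_mul] at hi
    simp only [add_mul, one_mul, Finset.sum_add_distrib, ite_mul, zero_mul,
      Finset.sum_ite_mem, Finset.univ_inter]
    rw [← hi, add_neg_cancel]

/- A relation `∑ t_ρ ray ρ = 0` is a curve class, whose intersection number with `D_ρ` is `t_ρ`. -/
lemma exists_addMonoidHom_divClass_pos : ∃ w : X.Pic →+ ℝ, ∀ ρ, 0 < w (X.divClass ρ) := by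
  obtain ⟨t, ht0, ht⟩ := X.exists_pos_sum_mul_ray_eq_zero
  let f : (R → ℤ) →+ ℝ := ∑ ρ, (AddMonoidHom.mulLeft (t ρ)).comp
    ((Int.castAddHom ℝ).comp (Pi.evalAddMonoidHom (fun _ => ℤ) ρ))
  have hfa (a : R → ℤ) : f a = ∑ ρ, t ρ * (a ρ : ℝ) := by simp [f]
  have hf : ∀ a ∈ X.divHom.range, f a = 0 := by
    rintro _ ⟨m, rfl⟩
    calc f (X.divHom m) = ∑ ρ, t ρ * ∑ i, (m i : ℝ) * X.ray ρ i := by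
          rw [hfa]
          simp [divHom]
      _ = ∑ i, m i * ∑ ρ, t ρ * (X.ray ρ i : ℝ) := by
          simp_rw [Finset.mul_sum]
          rw [Finset.sum_comm]
          exact Finset.sum_congr rfl fun i _ => Finset.sum_congr rfl fun ρ _ => by ring
      _ = 0 := by simp [ht]
  refine ⟨QuotientAddGroup.lift X.divHom.range f hf, fun ρ => ?_⟩
  change 0 < f (Pi.single ρ 1)
  simpa [hfa, Pi.single_apply] using ht0 ρ

variable {X}

lemma map_weight_divClass_pos {w : X.Pic →+ ℝ} (hw : ∀ ρ, 0 < w (X.divClass ρ)) {e : R →₀ ℕ}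
    (he : e ≠ 0) : 0 < w (Finsupp.weight X.divClass e) := by
  rw [Finsupp.weight_apply, Finsupp.sum, map_sum]
  refine Finset.sum_pos (fun ρ hρ => ?_) (Finsupp.support_nonempty_iff.mpr he)
  rw [map_nsmul]
  exact nsmul_pos (hw ρ) (Finsupp.mem_support_iff.mp hρ)

variable {k}

lemma eq_C_of_coeff_zero_ne_zero {α : X.Pic} {f : X.Cox k} (hf : f ∈ X.coxGrading k α)
    (h0 : f.coeff 0 ≠ 0) : f = MvPolynomial.C (f.coeff 0) := by
  obtain ⟨w, hw⟩ := X.exists_addMonoidHom_divClass_pos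
  ext e
  rw [MvPolynomial.coeff_C]
  split_ifs with h
  · rw [h]
  · by_contra he
    have hpos := map_weight_divClass_pos hw (Ne.symm h)
    rw [hf he, ← hf h0, map_zero, map_zero] at hpos
    exact lt_irrefl _ hpos

lemma monomial_mem_coxGrading (e : R →₀ ℕ) (c : k) :
    (MvPolynomial.monomial e c : X.Cox k) ∈ X.coxGrading k (Finsupp.weight X.divClass e) :=
  MvPolynomial.isWeightedHomogeneous_monomial _ _ _ rfl

open DirectSum

variable {M : Type*} [AddCommGroup M] [Module (X.Cox k) M]

section DecomposeSMul

variable (ℳ : X.Pic → AddSubgroup M) [SetLike.GradedSMul (X.coxGrading k) ℳ] [Decomposition ℳ]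

lemma decompose_smul_of_mem_coxGrading {β : X.Pic} {f : X.Cox k} (hf : f ∈ X.coxGrading k β)
    (y : M) (α : X.Pic) : (decompose ℳ (f • y) α : M) = f • (decompose ℳ y (α - β) : M) := by
  have h := decompose_map_of_injective ℳ ℳ (LinearMap.lsmul (X.Cox k) M f)
    (add_left_injective β) (fun γ m hm => X.smul_mem_graded k ℳ (add_comm γ β) hf hm) y (α - β)
  rwa [sub_add_cancel] at h

/- Only the constant term of `f` can reach the lowest degree of `y`. -/
lemma decompose_smul_of_forall_le {w : X.Pic →+ ℝ} (hw : ∀ ρ, 0 < w (X.divClass ρ)) {y : M}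
    {α : X.Pic} (hα : ∀ γ, decompose ℳ y γ ≠ 0 → w α ≤ w γ) (f : X.Cox k) :
    (decompose ℳ (f • y) α : M) =
      (MvPolynomial.C (f.coeff 0) : X.Cox k) • (decompose ℳ y α : M) := by
  induction f using MvPolynomial.induction_on' with
  | monomial e c =>
    rw [decompose_smul_of_mem_coxGrading ℳ (monomial_mem_coxGrading e c)]
    by_cases he : e = 0
    · rw [he, map_zero, sub_zero, MvPolynomial.monomial_zero', MvPolynomial.coeff_zero_C]
    · have hlt : w (α - Finsupp.weight X.divClass e) < w α := by
        rw [map_sub]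
        linarith [map_weight_divClass_pos hw he]
      have hzero : decompose ℳ y (α - Finsupp.weight X.divClass e) = 0 := by
        by_contra hne
        exact hlt.not_ge (hα _ hne)
      simp [hzero, MvPolynomial.coeff_monomial, he]
  | add p q hp hq =>
    rw [add_smul, decompose_add, DirectSum.add_apply, AddSubgroup.coe_add, hp, hq,
      MvPolynomial.coeff_add, map_add, add_smul]

end DecomposeSMul

lemma eq_zero_of_smul_eq_zero_of_coeff_zero_ne_zero (ℳ : X.Pic → AddSubgroup M)
    [SetLike.GradedSMul (X.coxGrading k) ℳ] [Decomposition ℳ] {f : X.Cox k} (hf : f.coeff 0 ≠ 0)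
    {y : M} (hy : f • y = 0) : y = 0 := by
  classical
  obtain ⟨w, hw⟩ := X.exists_addMonoidHom_divClass_pos
  by_contra hy0
  have hne : (decompose ℳ y).support.Nonempty := by
    rw [Finset.nonempty_iff_ne_empty, Ne, DFinsupp.support_eq_empty]
    exact fun h => hy0 ((decompose ℳ).injective (h.trans (decompose_zero ℳ).symm))
  obtain ⟨α, hα, hmin⟩ := Finset.exists_min_image _ w hne
  have hlow := decompose_smul_of_forall_le ℳ hw
    (fun γ hγ => hmin γ (DFinsupp.mem_support_iff.mpr hγ)) f
  have hunit : IsUnit (MvPolynomial.C (f.coeff 0) : X.Cox k) := (IsUnit.mk0 _ hf).map MvPolynomial.C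
  rw [hy, decompose_zero, DirectSum.zero_apply, AddSubgroup.coe_zero, eq_comm,
    hunit.smul_eq_zero] at hlow
  exact DFinsupp.mem_support_iff.mp hα (Subtype.ext hlow)

end Weight

section FreeGrading

open DirectSum

variable {X k} {b : ℕ} (a : Fin b → X.Pic)

lemma weightedHomogeneousComponent_coeAddMonoidHom_freeGrading
    (f : ⨁ α, X.freeGrading k a α) (α : X.Pic) (j : Fin b) :
    MvPolynomial.weightedHomogeneousComponent X.divClass (α - a j)
      (DirectSum.coeAddMonoidHom (X.freeGrading k a) f j) = (f α : Fin b → X.Cox k) j := by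
  induction f using DirectSum.induction_on with
  | zero => simp
  | of β x =>
    rw [coeAddMonoidHom_of, MvPolynomial.weightedHomogeneousComponent_of_mem (x.2 j), coe_of_apply]
    simp only [sub_left_inj, eq_comm (a := α)]
    split_ifs <;> rfl
  | add f g hf hg => simp [hf, hg]

variable {a} in
lemma single_mem_freeGrading {α : X.Pic} {j : Fin b} {x : X.Cox k}
    (hx : x ∈ X.coxGrading k (α - a j)) :
    (Pi.single j x : Fin b → X.Cox k) ∈ X.freeGrading k a α := fun l => by
  obtain rfl | hl := eq_or_ne l j
  · simpa using hx
  · simp [hl]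

lemma isInternal_freeGrading : IsInternal (X.freeGrading k a) := by
  refine ⟨fun f g hfg => ?_, fun x => ?_⟩
  · ext α j : 3
    rw [← weightedHomogeneousComponent_coeAddMonoidHom_freeGrading, hfg,
      weightedHomogeneousComponent_coeAddMonoidHom_freeGrading]
  · rw [← AddMonoidHom.mem_range, ← Finset.univ_sum_single x]
    refine sum_mem fun j _ => ?_
    induction x j using MvPolynomial.induction_on' with
    | monomial e c =>
      have hmem := single_mem_freeGrading (a := a) (j := j) (α := Finsupp.weight X.divClass e + a j)
        (x := MvPolynomial.monomial e c)
        (by rw [add_sub_cancel_right]; exact monomial_mem_coxGrading e c)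
      exact ⟨of (fun α => X.freeGrading k a α) _ ⟨_, hmem⟩, by simp⟩
    | add p q hp hq => simpa only [Pi.single_add] using add_mem hp hq

noncomputable instance freeGradingDecomposition : Decomposition (X.freeGrading k a) :=
  (isInternal_freeGrading a).chooseDecomposition

end FreeGrading

end SmoothProjectiveFan

/-! ### Localization and sections over affine charts -/

section LocalizedModule

variable {A : Type*} [CommRing A] (T : Submonoid A) {M N Q : Type*} [AddCommGroup M] [Module A M]
  [AddCommGroup N] [Module A N] [AddCommGroup Q] [Module A Q]

variable {T} in
lemma localizedModule_mk_eq_zero_iff {m : M} {t : T} :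
    LocalizedModule.mk m t = 0 ↔ ∃ s ∈ T, s • m = 0 := by
  rw [IsLocalizedModule.mk_eq_mk', IsLocalizedModule.mk'_eq_zero', Subtype.exists]
  simp [Submonoid.smul_def]

lemma localizedModule_mk_sum {ι : Type*} (s : Finset ι) (f : ι → M) (t : T) :
    LocalizedModule.mk (∑ i ∈ s, f i) t = ∑ i ∈ s, LocalizedModule.mk (f i) t := by
  simp only [IsLocalizedModule.mk_eq_mk']
  exact map_sum (AddMonoidHom.mk' (IsLocalizedModule.mk' (LocalizedModule.mkLinearMap T M) · t)
    fun x y => IsLocalizedModule.mk'_add _ x y t) f s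

lemma surjective_localizedModuleMap_of_forall (f : M →ₗ[A] N)
    (h : ∀ y, ∃ s ∈ T, s • y ∈ LinearMap.range f) :
    Function.Surjective (LocalizedModule.map T f) := by
  intro y
  induction y using LocalizedModule.induction_on with
  | h y t =>
    obtain ⟨s, hs, x, hx⟩ := h y
    refine ⟨LocalizedModule.mk x (⟨s, hs⟩ * t), ?_⟩
    rw [LocalizedModule.map_mk, hx]
    exact LocalizedModule.mk_cancel_common_left ⟨s, hs⟩ t y

lemma exact_localizedModuleMap_of_forall (f : M →ₗ[A] N) (g : N →ₗ[A] Q)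
    (hgf : ∀ x, ∃ s ∈ T, s • g (f x) = 0)
    (hker : ∀ y, g y = 0 → ∃ s ∈ T, s • y ∈ LinearMap.range f) :
    Function.Exact (LocalizedModule.map T f) (LocalizedModule.map T g) := by
  intro y
  induction y using LocalizedModule.induction_on with
  | h y t =>
    constructor
    · intro hy
      rw [LocalizedModule.map_mk, localizedModule_mk_eq_zero_iff] at hy
      obtain ⟨s, hs, hsy⟩ := hy
      obtain ⟨s', hs', x, hx⟩ := hker (s • y) (by rw [map_smul, hsy])
      refine ⟨LocalizedModule.mk x (⟨s', hs'⟩ * ⟨s, hs⟩ * t), ?_⟩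
      rw [LocalizedModule.map_mk, hx, smul_smul]
      exact LocalizedModule.mk_cancel_common_left (⟨s', hs'⟩ * ⟨s, hs⟩) t y
    · rintro ⟨x, hx⟩
      rw [← hx]
      induction x using LocalizedModule.induction_on with
      | h x t' => simpa only [LocalizedModule.map_mk, localizedModule_mk_eq_zero_iff] using hgf x

open DirectSum in
lemma exists_smul_mem_of_forall_decompose {ι : Type*} [DecidableEq ι] (ℳ : ι → AddSubgroup M)
    [Decomposition ℳ] (K : Submodule A M) (y : M)
    (h : ∀ i, ∃ s ∈ T, s • (decompose ℳ y i : M) ∈ K) : ∃ s ∈ T, s • y ∈ K := by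
  classical
  choose s hs hK using h
  refine ⟨∏ i ∈ (decompose ℳ y).support, s i, prod_mem fun i _ => hs i, ?_⟩
  nth_rewrite 2 [← sum_support_decompose ℳ y]
  rw [Finset.smul_sum]
  refine Submodule.sum_mem _ fun i hi => ?_
  rw [← Finset.mul_prod_erase _ s hi, mul_comm, mul_smul]
  exact Submodule.smul_mem _ _ (hK i)

end LocalizedModule

namespace SmoothProjectiveFan

variable {d : ℕ} {R : Type*} [Fintype R] [DecidableEq R] (X : SmoothProjectiveFan d R)
  (k : Type*) [Field k]

section Cone

lemma exists_character_of_mem_cones {σ : Finset R} (hσ : σ ∈ X.cones) (b : R → ℤ) :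
    ∃ m : Fin d → ℤ, ∀ ρ ∈ σ, X.divHom m ρ = b ρ := by
  obtain ⟨B, j, hj⟩ := X.smooth σ hσ
  let L : (Fin d → ℤ) →ₗ[ℤ] ℤ := B.constr ℤ (Function.extend j (fun ρ => b ρ) 0)
  refine ⟨fun i => L fun l => if i = l then 1 else 0, fun ρ hρ => ?_⟩
  calc ∑ i, L (fun l => if i = l then 1 else 0) * X.ray ρ i = L (X.ray ρ) := by
        rw [LinearMap.pi_apply_eq_sum_univ L (X.ray ρ)]
        exact Finset.sum_congr rfl fun i _ => mul_comm _ _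
    _ = b ρ := by
        rw [← hj ⟨ρ, hρ⟩, Module.Basis.constr_basis, j.injective.extend_apply]

/-- The map sending a torus-invariant divisor to its class in `Pic(X)`. -/
def divisorClass : (R → ℤ) →+ X.Pic := QuotientAddGroup.mk' X.divHom.range

lemma divisorClass_divHom (m : Fin d → ℤ) : X.divisorClass (X.divHom m) = 0 :=
  (QuotientAddGroup.eq_zero_iff _).mpr ⟨m, rfl⟩

lemma divisorClass_eq_sum (a : R → ℤ) : X.divisorClass a = ∑ ρ, a ρ • X.divClass ρ := by
  conv_lhs => rw [← Finset.univ_sum_single a, map_sum]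
  refine Finset.sum_congr rfl fun ρ _ => ?_
  rw [show X.divClass ρ = X.divisorClass (Pi.single ρ 1) from rfl, ← map_zsmul, ← Pi.single_smul,
    smul_eq_mul, mul_one]

/- As `σ` is smooth, a divisor can be moved away from `U_σ` by the divisor of a character. -/
lemma exists_eq_sum_compl_divClass {σ : Finset R} (hσ : σ ∈ X.cones) (α : X.Pic) :
    ∃ a : R → ℤ, α = ∑ ρ ∈ σᶜ, a ρ • X.divClass ρ := by
  obtain ⟨b, rfl⟩ : ∃ b, X.divisorClass b = α := QuotientAddGroup.mk'_surjective X.divHom.range α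
  obtain ⟨m, hm⟩ := X.exists_character_of_mem_cones hσ b
  refine ⟨b - X.divHom m, ?_⟩
  calc X.divisorClass b = X.divisorClass (b - X.divHom m) := by
        rw [map_sub, divisorClass_divHom, sub_zero]
    _ = ∑ ρ, (b - X.divHom m) ρ • X.divClass ρ := X.divisorClass_eq_sum _
    _ = ∑ ρ ∈ σᶜ, (b - X.divHom m) ρ • X.divClass ρ := by
        refine (Finset.sum_subset (Finset.subset_univ _) fun ρ _ hρ => ?_).symm
        rw [Pi.sub_apply, hm ρ (by simpa using hρ), sub_self, zero_smul]

lemma prod_X_pow_mem_coxGrading (s : Finset R) (e : R → ℕ) :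
    (∏ ρ ∈ s, MvPolynomial.X ρ ^ e ρ : X.Cox k) ∈
      X.coxGrading k (∑ ρ ∈ s, e ρ • X.divClass ρ) :=
  SetLike.prod_mem_graded _ _ _ fun ρ _ =>
    SetLike.pow_mem_graded _ (MvPolynomial.isWeightedHomogeneous_X k X.divClass ρ)

lemma exists_mul_eq_coneMonomial_pow {σ : Finset R} (hσ : σ ∈ X.cones) (α : X.Pic) :
    ∃ (n : ℕ) (p q : X.Cox k), p ∈ X.coxGrading k (n • X.coneDeg σ - α) ∧
      q ∈ X.coxGrading k (n • X.coneDeg σ + α) ∧ p * q = X.coneMonomial k σ ^ (n + n) := by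
  obtain ⟨a, rfl⟩ := X.exists_eq_sum_compl_divClass hσ α
  obtain ⟨n, hn⟩ : ∃ n : ℕ, ∀ ρ, |a ρ| ≤ n := by
    refine ⟨∑ ρ, (a ρ).natAbs, fun ρ => ?_⟩
    rw [Int.abs_eq_natAbs]
    exact_mod_cast Finset.single_le_sum (f := fun ρ => (a ρ).natAbs) (fun _ _ => Nat.zero_le _)
      (Finset.mem_univ ρ)
  choose e he using fun ρ => Int.eq_ofNat_of_zero_le (sub_nonneg.mpr ((abs_le.mp (hn ρ)).2))
  choose f hf using fun ρ => Int.eq_ofNat_of_zero_le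
    (neg_le_iff_add_nonneg'.mp (abs_le.mp (hn ρ)).1)
  refine ⟨n, ∏ ρ ∈ σᶜ, MvPolynomial.X ρ ^ e ρ, ∏ ρ ∈ σᶜ, MvPolynomial.X ρ ^ f ρ, ?_, ?_, ?_⟩
  · convert X.prod_X_pow_mem_coxGrading k σᶜ e using 2
    simp only [coneDeg, Finset.smul_sum, Finset.sum_sub_distrib, ← natCast_zsmul, ← he, sub_smul]
  · convert X.prod_X_pow_mem_coxGrading k σᶜ f using 2
    simp only [coneDeg, Finset.smul_sum, Finset.sum_add_distrib, ← natCast_zsmul, ← hf, add_smul]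
  · rw [← Finset.prod_mul_distrib, coneMonomial, ← Finset.prod_pow]
    refine Finset.prod_congr rfl fun ρ _ => ?_
    rw [← pow_add]
    congr 1
    have := he ρ
    have := hf ρ
    omega

end Cone

section Sections

variable {L : Type*} [AddCommGroup L] [Module (X.Cox k) L] (ℒ : X.Pic → AddSubgroup L)
  [SetLike.GradedSMul (X.coxGrading k) ℒ]
  {M : Type*} [AddCommGroup M] [Module (X.Cox k) M] (ℳ : X.Pic → AddSubgroup M)
  [SetLike.GradedSMul (X.coxGrading k) ℳ]
  {N : Type*} [AddCommGroup N] [Module (X.Cox k) N] (𝒩 : X.Pic → AddSubgroup N)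
  [SetLike.GradedSMul (X.coxGrading k) 𝒩]

variable {X k} in
lemma mk_conePow_eq_iff {σ : Finset R} {n n' : ℕ} {m m' : M} :
    LocalizedModule.mk m (X.conePow k σ n) = LocalizedModule.mk m' (X.conePow k σ n') ↔
      ∃ t : ℕ, X.coneMonomial k σ ^ t • X.coneMonomial k σ ^ n' • m =
        X.coneMonomial k σ ^ t • X.coneMonomial k σ ^ n • m' := by
  refine LocalizedModule.mk_eq.trans ⟨?_, ?_⟩
  · rintro ⟨⟨_, t, rfl⟩, h⟩
    exact ⟨t, h⟩
  · rintro ⟨t, h⟩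
    exact ⟨⟨_, t, rfl⟩, h⟩

variable {X k} in
lemma mk_conePow_eq_zero_iff {σ : Finset R} {n : ℕ} {m : M} :
    LocalizedModule.mk m (X.conePow k σ n) = 0 ↔ ∃ t : ℕ, X.coneMonomial k σ ^ t • m = 0 := by
  rw [localizedModule_mk_eq_zero_iff]
  simp [Submonoid.mem_powers_iff]

lemma conePow_mul (σ : Finset R) (n m : ℕ) :
    X.conePow k σ n * X.conePow k σ m = X.conePow k σ (n + m) :=
  Subtype.ext (pow_add _ _ _).symm

/-- The section `m / c ^ n` of `M~` on `U_σ`, where `c` is `coneMonomial σ`. -/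
noncomputable def mkSection (σ : Finset R) (n : ℕ) (m : M) (hm : m ∈ ℳ (n • X.coneDeg σ)) :
    X.sections k ℳ σ := ⟨LocalizedModule.mk m (X.conePow k σ n), n, m, hm, rfl⟩

/-- The element `a / c ^ n` of the coordinate ring of `U_σ`, where `c` is `coneMonomial σ`. -/
noncomputable def mkChart (σ : Finset R) (n : ℕ) (a : X.Cox k)
    (ha : a ∈ X.coxGrading k (n • X.coneDeg σ)) : X.chartRing k σ :=
  ⟨Localization.mk a (X.conePow k σ n), n, a, ha, rfl⟩

lemma exists_eq_mkSection {σ : Finset R} (z : X.sections k ℳ σ) :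
    ∃ n m hm, z = X.mkSection k ℳ σ n m hm := by
  obtain ⟨_, n, m, hm, rfl⟩ := z
  exact ⟨n, m, hm, rfl⟩

/-- The map `φ` of sections over `U_σ` is induced by the homomorphism `η` of degree `l • coneDeg σ`,
in the sense that `φ (m / c ^ n) = η m / c ^ (n + l)`, where `c` is `coneMonomial σ`. The shift `l`
is needed because a map of sections need only be induced by a homomorphism after multiplication by
a power of `c`. -/
structure IsInducedBy {σ : Finset R} (φ : X.sections k ℳ σ → X.sections k 𝒩 σ)
    (η : M →ₗ[X.Cox k] N) (l : ℕ) : Prop where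
  map_mem : ∀ α, ∀ m ∈ ℳ α, η m ∈ 𝒩 (α + l • X.coneDeg σ)
  coe_apply_mkSection : ∀ n m hm, (φ (X.mkSection k ℳ σ n m hm) : LocalizedModule _ N) =
    LocalizedModule.mk (η m) (X.conePow k σ (n + l))

variable {X k} {ℒ ℳ 𝒩} {σ : Finset R}

lemma isInducedBy_sectionsMap {f : M →ₗ[X.Cox k] N} (hf : ∀ α, ∀ m ∈ ℳ α, f m ∈ 𝒩 α) :
    X.IsInducedBy k ℳ 𝒩 (X.sectionsMap k ℳ 𝒩 f hf σ) f 0 where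
  map_mem := by simpa using hf
  coe_apply_mkSection n m _ :=
    LocalizedModule.map_mk (S := X.coneSub k σ) f m (X.conePow k σ n)

lemma IsInducedBy.exists_smul_mem_range {φ : X.sections k ℳ σ → X.sections k 𝒩 σ}
    {η : M →ₗ[X.Cox k] N} {l : ℕ} (h : X.IsInducedBy k ℳ 𝒩 φ η l) {n : ℕ} {z : N}
    {hz : z ∈ 𝒩 (n • X.coneDeg σ)} (hφ : X.mkSection k 𝒩 σ n z hz ∈ Set.range φ) :
    ∃ t : ℕ, X.coneMonomial k σ ^ t • z ∈ LinearMap.range η := by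
  obtain ⟨w, hw⟩ := hφ
  obtain ⟨n', x, hx, rfl⟩ := X.exists_eq_mkSection k ℳ w
  obtain ⟨t, ht⟩ := mk_conePow_eq_iff.mp
    ((h.coe_apply_mkSection n' x hx).symm.trans (congrArg Subtype.val hw))
  refine ⟨t + (n' + l), ?_⟩
  rw [pow_add, mul_smul, ← ht, ← map_smul, ← map_smul]
  exact LinearMap.mem_range_self η _

variable {P : Ideal (X.Cox k)} [P.IsPrime]

open DirectSum

/- The degree of `y` can be moved to a multiple of `coneDeg σ` by a monomial outside `P`. -/
lemma exists_smul_mem_of_forall_coneDeg [Decomposition ℳ] (hσ : σ ∈ X.cones)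
    (hP : X.coneMonomial k σ ∉ P) {H K : Submodule (X.Cox k) M}
    (hH : ∀ y ∈ H, ∀ α, (decompose ℳ y α : M) ∈ H)
    (h : ∀ n : ℕ, ∀ z ∈ H, z ∈ ℳ (n • X.coneDeg σ) → ∃ t : ℕ, X.coneMonomial k σ ^ t • z ∈ K)
    {y : M} (hy : y ∈ H) : ∃ s ∈ P.primeCompl, s • y ∈ K := by
  refine exists_smul_mem_of_forall_decompose P.primeCompl ℳ K y fun α => ?_
  obtain ⟨n, p, q, hp, -, hpq⟩ := X.exists_mul_eq_coneMonomial_pow k hσ α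
  have hpP : p ∈ P.primeCompl := fun hpP =>
    pow_mem (S := P.primeCompl) hP (n + n) (hpq ▸ P.mul_mem_right q hpP)
  obtain ⟨t, ht⟩ := h n _ (H.smul_mem p (hH y hy α))
    (X.smul_mem_graded k ℳ (sub_add_cancel _ α).symm hp (SetLike.coe_mem _))
  exact ⟨X.coneMonomial k σ ^ t * p, mul_mem (pow_mem hP t) hpP, by rwa [mul_smul]⟩

lemma IsInducedBy.surjective_localizedModuleMap [Decomposition 𝒩]
    {φ : X.sections k ℳ σ → X.sections k 𝒩 σ} {η : M →ₗ[X.Cox k] N} {l : ℕ}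
    (h : X.IsInducedBy k ℳ 𝒩 φ η l) (hσ : σ ∈ X.cones) (hP : X.coneMonomial k σ ∉ P)
    (hφ : Function.Surjective φ) : Function.Surjective (LocalizedModule.map P.primeCompl η) :=
  surjective_localizedModuleMap_of_forall _ η fun _ =>
    exists_smul_mem_of_forall_coneDeg (ℳ := 𝒩) hσ hP (H := ⊤) (fun _ _ _ => Submodule.mem_top)
      (fun n z _ hz => h.exists_smul_mem_range (hφ (X.mkSection k 𝒩 σ n z hz))) Submodule.mem_top

lemma IsInducedBy.exact_localizedModuleMap [Decomposition ℒ] [Decomposition ℳ] [Decomposition 𝒩]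
    {φ : X.sections k ℒ σ → X.sections k ℳ σ} {ψ : X.sections k ℳ σ → X.sections k 𝒩 σ}
    {η : L →ₗ[X.Cox k] M} {θ : M →ₗ[X.Cox k] N} {l l' : ℕ} (hη : X.IsInducedBy k ℒ ℳ φ η l)
    (hθ : X.IsInducedBy k ℳ 𝒩 ψ θ l') (hσ : σ ∈ X.cones) (hP : X.coneMonomial k σ ∉ P)
    (h : Function.Exact φ ψ) :
    Function.Exact (LocalizedModule.map P.primeCompl η) (LocalizedModule.map P.primeCompl θ) := by
  refine exact_localizedModuleMap_of_forall _ η θ (fun x => ?_) fun y hy => ?_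
  · suffices ∃ s ∈ P.primeCompl, s • x ∈ LinearMap.ker (θ ∘ₗ η) by simpa using this
    refine exists_smul_mem_of_forall_coneDeg (ℳ := ℒ) hσ hP (H := ⊤)
      (fun _ _ _ => Submodule.mem_top) (fun n z _ hz => ?_) Submodule.mem_top
    obtain ⟨m, hm, hφ⟩ : ∃ m hm, φ (X.mkSection k ℒ σ n z hz) = X.mkSection k ℳ σ (n + l) m hm ∧
        m = η z := ⟨η z, by rw [add_smul]; exact hη.map_mem _ z hz,
          Subtype.ext (hη.coe_apply_mkSection n z hz), rfl⟩
    have hzero := h.apply_apply_eq_zero (X.mkSection k ℒ σ n z hz)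
    rw [hφ.1, Subtype.ext_iff, hθ.coe_apply_mkSection] at hzero
    obtain ⟨t, ht⟩ := mk_conePow_eq_zero_iff.mp hzero
    exact ⟨t, by simpa [hφ.2] using ht⟩
  · refine exists_smul_mem_of_forall_coneDeg (ℳ := ℳ) hσ hP (H := LinearMap.ker θ)
      (fun _ hy => map_decompose_eq_zero_of_injective ℳ 𝒩 (add_left_injective _) hθ.map_mem hy)
      (fun n z hzθ hz => ?_) hy
    refine hη.exists_smul_mem_range (n := n) (hz := hz) ((h _).mp (Subtype.ext ?_))
    rw [hθ.coe_apply_mkSection, LinearMap.mem_ker.mp hzθ, LocalizedModule.zero_mk]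
    rfl

end Sections

variable {X k}

section FreeSections

variable {M : Type*} [AddCommGroup M] [Module (X.Cox k) M] {ℳ : X.Pic → AddSubgroup M}
  [SetLike.GradedSMul (X.coxGrading k) ℳ] {σ : Finset R}

/- Instance search does not find this module structure within the default limits. -/
noncomputable instance sectionsSMul : SMul (X.chartRing k σ) (X.sections k ℳ σ) :=
  (Submodule.module (X.sections k ℳ σ)).toSMul

lemma coe_mkChart_smul_mkSection {n n' : ℕ} {x : X.Cox k} {m : M}
    (hx : x ∈ X.coxGrading k (n • X.coneDeg σ)) (hm : m ∈ ℳ (n' • X.coneDeg σ)) :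
    ((X.mkChart k σ n x hx • X.mkSection k ℳ σ n' m hm : X.sections k ℳ σ) :
      LocalizedModule _ M) = LocalizedModule.mk (x • m) (X.conePow k σ (n + n')) := by
  rw [← conePow_mul]
  exact LocalizedModule.mk_smul_mk x m (X.conePow k σ n) (X.conePow k σ n')

variable {b : ℕ} {a : Fin b → X.Pic}

/- `e j / 1` need not be a section over `U_σ`, but `p • e j / c ^ n` is one for a suitable monomial
`p` dividing a power of `c = coneMonomial σ`, and every section in the `j`-th summand is a multiple
of it. -/
lemma exists_forall_coe_apply_mkSection_single (hσ : σ ∈ X.cones)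
    (φ : X.sections k (X.freeGrading k a) σ →ₗ[X.chartRing k σ] X.sections k ℳ σ) (j : Fin b) :
    ∃ l₀ : ℕ, ∀ l ≥ l₀, ∃ v ∈ ℳ (a j + l • X.coneDeg σ),
      ∀ n x (hx : x ∈ X.coxGrading k (n • X.coneDeg σ - a j)),
        (φ (X.mkSection k _ σ n (Pi.single j x) (single_mem_freeGrading hx)) :
          LocalizedModule _ M) = LocalizedModule.mk (x • v) (X.conePow k σ (n + l)) := by
  obtain ⟨n₀, p, q, hp, hq, hpq⟩ := X.exists_mul_eq_coneMonomial_pow k hσ (a j)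
  obtain ⟨n₁, m, hm, hφ⟩ := X.exists_eq_mkSection k ℳ
    (φ (X.mkSection k _ σ n₀ (Pi.single j p) (single_mem_freeGrading hp)))
  refine ⟨n₀ + n₁, fun l hl => ?_⟩
  obtain ⟨i, rfl⟩ := Nat.exists_eq_add_of_le hl
  refine ⟨(X.coneMonomial k σ ^ i * q) • m, X.smul_mem_graded k ℳ ?_
    (SetLike.mul_mem_graded (X.coneMonomial_pow_mem k σ i) hq) hm, fun n x hx => ?_⟩
  · module
  have hxq : x * q ∈ X.coxGrading k ((n + n₀) • X.coneDeg σ) := by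
    convert SetLike.mul_mem_graded hx hq using 2
    module
  have hmul : X.mkSection k _ σ n (Pi.single j x) (single_mem_freeGrading hx) =
      X.mkChart k σ (n + n₀) (x * q) hxq •
        X.mkSection k (X.freeGrading k a) σ n₀ (Pi.single j p) (single_mem_freeGrading hp) := by
    refine Subtype.ext ((mk_conePow_eq_iff.mpr ⟨0, ?_⟩).trans
      (coe_mkChart_smul_mkSection _ _).symm)
    simp only [← Pi.single_smul, smul_eq_mul]
    congr 1
    rw [add_assoc, pow_add _ n, ← hpq]
    ring
  rw [hmul, map_smul, hφ, coe_mkChart_smul_mkSection, mk_conePow_eq_iff]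
  refine ⟨0, ?_⟩
  simp only [smul_smul]
  congr 1
  ring

lemma exists_isInducedBy (hσ : σ ∈ X.cones)
    (φ : X.sections k (X.freeGrading k a) σ →ₗ[X.chartRing k σ] X.sections k ℳ σ) :
    ∃ η l, X.IsInducedBy k (X.freeGrading k a) ℳ φ η l := by
  choose l₀ h using exists_forall_coe_apply_mkSection_single hσ φ
  choose v hv hφ using fun j =>
    h j (∑ j, l₀ j) (Finset.single_le_sum (fun _ _ => Nat.zero_le _) (Finset.mem_univ j))
  refine ⟨Fintype.linearCombination (X.Cox k) v, ∑ j, l₀ j, fun α x hx => ?_, fun n x hx => ?_⟩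
  · rw [Fintype.linearCombination_apply]
    exact sum_mem fun j _ => X.smul_mem_graded k ℳ (by abel) (hx j) (hv j)
  · have hsum : X.mkSection k (X.freeGrading k a) σ n x hx =
        ∑ j, X.mkSection k _ σ n (Pi.single j (x j)) (single_mem_freeGrading (hx j)) := by
      refine Subtype.ext ?_
      rw [Submodule.coe_sum]
      simp only [mkSection, ← localizedModule_mk_sum, Finset.univ_sum_single]
    rw [hsum, map_sum, Submodule.coe_sum, Fintype.linearCombination_apply,
      localizedModule_mk_sum]
    exact Finset.sum_congr rfl fun j _ => hφ j n (x j) (hx j)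

end FreeSections

end SmoothProjectiveFan

/-! ### Virtual resolutions and geometric Cohen–Macaulayness -/

section CohenMacaulay

variable {A : Type*} [CommRing A] [IsLocalRing A] {N : Type*} [AddCommGroup N] [Module A N]

lemma HasDepthGE.le_localDepth [Nontrivial N] {n : ℕ} (h : HasDepthGE A N n) :
    n ≤ localDepth A N := by
  obtain ⟨rs, rfl, hrs⟩ := HasDepthGE.iff_exists_isRegular.mp h
  exact le_iSup₂_of_le rs hrs le_rfl

variable [IsNoetherianRing A] [Module.Finite A N]

variable (A N) in
lemma localDepth_le_supportDim [Nontrivial N] :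
    (localDepth A N : WithBot ℕ∞) ≤ Module.supportDim A N := by
  obtain ⟨D, hD⟩ := WithBot.ne_bot_iff_exists.mp (Module.supportDim_ne_bot_of_nontrivial A N)
  rw [← hD, WithBot.coe_le_coe]
  refine iSup₂_le fun rs hrs => WithBot.coe_le_coe.mp (hD ▸ ?_)
  exact HasDepthGE.le_supportDim (.inr ⟨rs, rfl, hrs⟩)

lemma HasDepthGE.isLocalCohenMacaulay {r c : ℕ} (h : HasDepthGE A N (r - c))
    (hdim : Module.supportDim A N + c ≤ r) : IsLocalCohenMacaulay A N := by
  rcases subsingleton_or_nontrivial N with hN | hN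
  · exact .inl hN
  refine .inr ((localDepth_le_supportDim A N).antisymm ?_)
  refine le_trans ?_ (WithBot.coe_le_coe.mpr h.le_localDepth)
  generalize Module.supportDim A N = D at hdim
  induction D with
  | bot => exact bot_le
  | coe D =>
    induction D with
    | top => norm_cast at hdim
    | coe D => norm_cast at hdim ⊢; lia

lemma supportDim_add_height_annihilator_le (A : Type*) [CommRing A] [IsNoetherianRing A]
    (M : Type*) [AddCommGroup M] [Module A M] [Module.Finite A M] (P : Ideal A) [P.IsPrime] :
    Module.supportDim (Localization.AtPrime P) (LocalizedModule P.primeCompl M) +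
      (Module.annihilator A M).height ≤ (P.height : WithBot ℕ∞) := by
  set B := Localization.AtPrime P
  have hle : Module.annihilator A M ≤
      (Module.annihilator B (LocalizedModule P.primeCompl M)).under A := by
    intro x hx
    rw [Ideal.mem_comap, Module.mem_annihilator]
    intro m
    induction m using LocalizedModule.induction_on with
    | h m t =>
      rw [algebraMap_smul, LocalizedModule.smul'_mk, Module.mem_annihilator.mp hx,
        LocalizedModule.zero_mk]
  have hheight := (Ideal.height_mono hle).trans_eq (IsLocalization.height_under P.primeCompl _)
  rw [Module.supportDim_eq_ringKrullDim_quotient_annihilator,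
    ← IsLocalization.AtPrime.ringKrullDim_eq_height P B, add_comm]
  refine le_trans ?_ (height_add_ringKrullDim_quotient_le
    (Module.annihilator B (LocalizedModule P.primeCompl M)))
  gcongr
  exact_mod_cast hheight

end CohenMacaulay

namespace SmoothProjectiveFan

section VirtualResolution

variable {d : ℕ} {R : Type*} [Fintype R] [DecidableEq R] {X : SmoothProjectiveFan d R}
  {k : Type*} [Field k]

lemma exists_coneMonomial_notMem {P : Ideal (X.Cox k)} (hP : X.IsRelevant k P) :
    ∃ σ ∈ X.cones, X.coneMonomial k σ ∉ P := by
  by_contra! h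
  refine hP 1 le_rfl ?_
  rw [pow_one, irrelevantIdeal, Ideal.span_le]
  rintro _ ⟨σ, hσ, rfl⟩
  exact h σ hσ

variable {M : Type*} [AddCommGroup M] [Module (X.Cox k) M] {ℳ : X.Pic → AddSubgroup M}
  [SetLike.GradedSMul (X.coxGrading k) ℳ]

lemma exists_isRelevant_mem_support (h : X.SheafNeZero k ℳ) :
    ∃ P ∈ Module.support (X.Cox k) M, X.IsRelevant k P.asIdeal := by
  obtain ⟨σ, hσ, hn⟩ := h
  obtain ⟨z, hz⟩ := exists_ne (0 : X.sections k ℳ σ)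
  obtain ⟨n, m, hm, rfl⟩ := X.exists_eq_mkSection k ℳ z
  have hpow : ∀ t : ℕ, X.coneMonomial k σ ^ t • m ≠ 0 := fun t ht =>
    hz (Subtype.ext (mk_conePow_eq_zero_iff.mpr ⟨t, ht⟩))
  obtain ⟨P, hP, hle, hdisj⟩ := Ideal.exists_le_prime_disjoint
    (Submodule.span (X.Cox k) {m}).annihilator (X.coneSub k σ) <| by
      rw [Set.disjoint_left]
      rintro _ hx ⟨t, rfl⟩
      exact hpow t ((Submodule.mem_annihilator_span_singleton _ _).mp hx)
  refine ⟨⟨P, hP⟩, Module.mem_support_iff_exists_annihilator.mpr ⟨m, hle⟩, fun t _ ht => ?_⟩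
  exact Set.disjoint_left.mp hdisj (hP.le_of_pow_le ht (Ideal.subset_span ⟨σ, hσ, rfl⟩))
    ⟨1, pow_one _⟩

lemma exists_isVirtualResolution_of_vdim_ne_top (h : X.vdim k ℳ ≠ ⊤) :
    ∃ (F : X.FreeComplex k) (n : ℕ),
      F.IsVirtualResolution ℳ ∧ F.HasLengthLE n ∧ X.vdim k ℳ = n := by
  refine csInf_mem (s := {l : ℕ∞ | ∃ (F : X.FreeComplex k) (n : ℕ),
    F.IsVirtualResolution ℳ ∧ F.HasLengthLE n ∧ l = n}) ?_
  by_contra hempty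
  exact h ((congrArg sInf (Set.not_nonempty_iff_eq_empty.mp hempty)).trans sInf_empty)

variable [DirectSum.Decomposition ℳ]

lemma FreeComplex.IsVirtualResolution.exists_exact_localizedModuleMap {F : X.FreeComplex k}
    (hF : F.IsVirtualResolution ℳ) {P : Ideal (X.Cox k)} [P.IsPrime] (hP : X.IsRelevant k P) :
    ∃ η : (Fin (F.rank 0) → X.Cox k) →ₗ[X.Cox k] M,
      Function.Surjective (LocalizedModule.map P.primeCompl η) ∧
      Function.Exact (LocalizedModule.map P.primeCompl (F.diff 0))
        (LocalizedModule.map P.primeCompl η) ∧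
      ∀ i, Function.Exact (LocalizedModule.map P.primeCompl (F.diff (i + 1)))
        (LocalizedModule.map P.primeCompl (F.diff i)) := by
  obtain ⟨σ, hσ, hcP⟩ := exists_coneMonomial_notMem hP
  obtain ⟨ε, hε⟩ := hF
  obtain ⟨hsurj, hexact₀, hexact⟩ := hε σ hσ
  obtain ⟨η, l, hη⟩ := exists_isInducedBy hσ (ε.app σ hσ)
  have hdiff (i : ℕ) := isInducedBy_sectionsMap (σ := σ) (F.diff_deg i)
  exact ⟨η, hη.surjective_localizedModuleMap hσ hcP hsurj,
    (hdiff 0).exact_localizedModuleMap hη hσ hcP hexact₀,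
    fun i => (hdiff (i + 1)).exact_localizedModuleMap (hdiff i) hσ hcP (hexact i)⟩

lemma FreeComplex.IsVirtualResolution.hasDepthGE {F : X.FreeComplex k}
    (hF : F.IsVirtualResolution ℳ) {n : ℕ} (hn : F.HasLengthLE n) {P : Ideal (X.Cox k)} [P.IsPrime]
    (hP : X.IsRelevant k P) {r : ℕ} (hr : P.height = r) :
    HasDepthGE (Localization.AtPrime P) (LocalizedModule P.primeCompl M) (r - n) := by
  obtain ⟨η, hsurj, hexact₀, hexact⟩ := hF.exists_exact_localizedModuleMap hP
  have hfree (i : ℕ) : Module.Free (Localization.AtPrime P)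
      (LocalizedModule P.primeCompl (Fin (F.rank i) → X.Cox k)) :=
    Module.free_of_isLocalizedModule P.primeCompl (LocalizedModule.mkLinearMap P.primeCompl _)
  have hdepth : HasDepthGE (Localization.AtPrime P) (Localization.AtPrime P) r := by
    have hedim := (IsRegularLocalRing.spanFinrank_maximalIdeal (R := Localization.AtPrime P)).trans
      (IsLocalization.AtPrime.ringKrullDim_eq_height P (Localization.AtPrime P))
    rw [hr] at hedim
    norm_cast at hedim
    exact hedim ▸ HasDepthGE.of_isRegularLocalRing (Localization.AtPrime P)
  refine (hdepth.quotient_range_of_resolution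
    (fun i => LocalizedModule P.primeCompl (Fin (F.rank i) → X.Cox k))
    (fun i => LocalizedModule.map P.primeCompl (F.diff i)) hexact fun i hi => ?_).congr
      (hexact₀.linearEquivOfSurjective hsurj)
  have : Subsingleton (Fin (F.rank i) → X.Cox k) := by
    rw [hn i hi]
    infer_instance
  infer_instance

variable [Module.Finite (X.Cox k) M]

lemma FreeComplex.IsVirtualResolution.codim_le (h : X.SheafNeZero k ℳ) {F : X.FreeComplex k}
    (hF : F.IsVirtualResolution ℳ) {n : ℕ} (hn : F.HasLengthLE n) : X.codim k M ≤ n := by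
  obtain ⟨P, hmem, hrel⟩ := exists_isRelevant_mem_support h
  have hN : Nontrivial (LocalizedModule P.asIdeal.primeCompl M) := hmem
  obtain ⟨r, hr⟩ := ENat.ne_top_iff_exists.mp (Ideal.height_ne_top P.isPrime.ne_top)
  have hle : ((r - n : ℕ) : WithBot ℕ∞) + X.codim k M ≤ P.asIdeal.height :=
    (add_le_add_left (hF.hasDepthGE hn hrel hr.symm).le_supportDim _).trans
      (supportDim_add_height_annihilator_le (X.Cox k) M P.asIdeal)
  rw [← hr, ← WithBot.coe_natCast, ← WithBot.coe_add, WithBot.coe_le_coe] at hle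
  generalize X.codim k M = c at hle ⊢
  induction c with
  | top => norm_cast at hle
  | coe c => norm_cast at hle ⊢; lia

theorem codim_le_vdim (h : X.SheafNeZero k ℳ) : X.codim k M ≤ X.vdim k ℳ := by
  refine le_sInf ?_
  rintro _ ⟨F, n, hF, hn, rfl⟩
  exact hF.codim_le h hn

theorem IsVirtuallyCM.isGeometricallyCM (h : X.IsVirtuallyCM k ℳ) : X.IsGeometricallyCM k M := by
  intro P hmem hrel
  obtain ⟨c, hc⟩ := ENat.ne_top_iff_exists.mp (Ideal.height_ne_top
    (ne_top_of_le_ne_top P.isPrime.ne_top (Module.annihilator_le_of_mem_support hmem)))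
  have hvdim : X.vdim k ℳ = c := h.2.trans hc.symm
  obtain ⟨F, n, hF, hn, hvdim'⟩ :=
    exists_isVirtualResolution_of_vdim_ne_top (hvdim.trans_ne (ENat.natCast_ne_top c))
  obtain rfl : c = n := by exact_mod_cast hvdim.symm.trans hvdim'
  obtain ⟨r, hr⟩ := ENat.ne_top_iff_exists.mp (Ideal.height_ne_top P.isPrime.ne_top)
  have hle := supportDim_add_height_annihilator_le (X.Cox k) M P.asIdeal
  refine (hF.hasDepthGE hn hrel hr.symm).isLocalCohenMacaulay ?_
  rw [← hr, ← hc] at hle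
  exact hle

end VirtualResolution

end SmoothProjectiveFan

/-! ### Minimal free resolutions -/

section MinimalResolution

open IsLocalRing

lemma ker_eq_bot_of_le_maximalIdeal_smul_top {A : Type*} [CommRing A] [IsLocalRing A]
    {F N : Type*} [AddCommGroup F] [Module A F] [IsNoetherian A F] [AddCommGroup N] [Module A N]
    [Module.Projective A N] {g : F →ₗ[A] N} (hg : Function.Surjective g)
    (h : LinearMap.ker g ≤ maximalIdeal A • (⊤ : Submodule A F)) : LinearMap.ker g = ⊥ := by
  obtain ⟨s, hs⟩ := Module.projective_lifting_property g LinearMap.id hg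
  let p : F →ₗ[A] F := LinearMap.id - s ∘ₗ g
  have hgs (y : N) : g (s y) = y := LinearMap.congr_fun hs y
  have hp : LinearMap.range p ≤ LinearMap.ker g := by
    rintro _ ⟨x, rfl⟩
    simp [p, hgs]
  refine Submodule.eq_bot_of_le_smul_of_le_jacobson_bot (maximalIdeal A) _
    (IsNoetherian.noetherian _) ?_ (maximalIdeal_le_jacobson _)
  calc LinearMap.ker g ≤ (LinearMap.ker g).map p := fun x hx =>
        ⟨x, hx, by simp [p, LinearMap.mem_ker.mp hx]⟩
    _ ≤ (maximalIdeal A • (⊤ : Submodule A F)).map p := Submodule.map_mono h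
    _ = maximalIdeal A • LinearMap.range p := by
        rw [Submodule.map_smul'', Submodule.map_top]
    _ ≤ maximalIdeal A • LinearMap.ker g := Submodule.smul_mono le_rfl hp

variable {A : Type u} [CommRing A] {F : ℕ → Type v} [∀ i, AddCommGroup (F i)]
  [∀ i, Module A (F i)] [∀ i, Module.Finite A (F i)] [∀ i, Module.Free A (F i)]
  {f : ∀ i, F (i + 1) →ₗ[A] F i} {δ : ℕ} [Small.{v} A]

lemma HasDepthGE.range_of_resolution [IsLocalRing A] [IsNoetherianRing A] {n : ℕ}
    (hA : HasDepthGE A A n) (hf : ∀ i, Function.Exact (f (i + 1)) (f i))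
    (h : HasDepthGE A (F 0 ⧸ LinearMap.range (f 0)) δ) (i : ℕ) (hi : δ + i + 1 ≤ n) :
    HasDepthGE A (LinearMap.range (f i)) (δ + i + 1) := by
  induction i with
  | zero =>
    exact .of_exact_left (Submodule.subtype_injective _) (Submodule.mkQ_surjective _)
      (LinearMap.exact_subtype_mkQ _) ((hA.free (F 0)).mono hi) h
  | succ i ih =>
    refine .of_exact_left (Submodule.subtype_injective _) (f i).surjective_rangeRestrict
      (fun y => ?_) ((hA.free (F (i + 1))).mono hi) (ih (by lia))
    rw [Subtype.ext_iff]
    simpa using hf i y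

theorem eq_zero_of_minimal_resolution [IsRegularLocalRing A]
    (hf : ∀ i, Function.Exact (f (i + 1)) (f i))
    (hmin : ∀ i, LinearMap.range (f i) ≤ maximalIdeal A • (⊤ : Submodule A (F i)))
    (h : HasDepthGE A (F 0 ⧸ LinearMap.range (f 0)) δ) :
    f ((maximalIdeal A).spanFinrank - δ) = 0 := by
  rw [← LinearMap.range_eq_bot]
  rcases hn : (maximalIdeal A).spanFinrank - δ with _ | e
  · have := HasDepthGE.free_of_isRegularLocalRing (h.mono (Nat.sub_eq_zero_iff_le.mp hn))
    rw [← (LinearMap.range (f 0)).ker_mkQ]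
    exact ker_eq_bot_of_le_maximalIdeal_smul_top (Submodule.mkQ_surjective _)
      ((Submodule.ker_mkQ _).trans_le (hmin 0))
  · have hrange := (HasDepthGE.of_isRegularLocalRing A).range_of_resolution hf h e (by lia)
    rw [show δ + e + 1 = (maximalIdeal A).spanFinrank by lia] at hrange
    have := HasDepthGE.free_of_isRegularLocalRing hrange
    rw [← (hf e).linearMap_ker_eq, ← (f e).ker_rangeRestrict]
    refine ker_eq_bot_of_le_maximalIdeal_smul_top (f e).surjective_rangeRestrict ?_
    rw [(f e).ker_rangeRestrict, (hf e).linearMap_ker_eq]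
    exact hmin (e + 1)

end MinimalResolution

lemma span_range_comp_succAbove_eq {A M : Type*} [Ring A] [AddCommGroup M] [Module A M] {b : ℕ}
    {y : Fin (b + 1) → M} {z : Fin (b + 1) → A} (hz : ∑ i, z i • y i = 0) {j : Fin (b + 1)}
    (hj : IsUnit (z j)) :
    Submodule.span A (Set.range (y ∘ j.succAbove)) = Submodule.span A (Set.range y) := by
  refine (Submodule.span_mono (Set.range_comp_subset_range _ _)).antisymm ?_
  rw [Submodule.span_le]
  have hy (i : Fin b) : y (j.succAbove i) ∈ Submodule.span A (Set.range (y ∘ j.succAbove)) :=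
    Submodule.subset_span ⟨i, rfl⟩
  rintro _ ⟨i, rfl⟩
  induction i using Fin.succAboveCases j with
  | x =>
    rw [Fin.sum_univ_succAbove _ j, add_eq_zero_iff_eq_neg] at hz
    rw [SetLike.mem_coe, ← Submodule.smul_mem_iff_of_isUnit _ hj, hz]
    exact neg_mem (sum_mem fun l _ => Submodule.smul_mem _ _ (hy l))
  | p i => exact hy i

namespace SmoothProjectiveFan

open DirectSum

variable {d : ℕ} {R : Type*} [Fintype R] [DecidableEq R] {X : SmoothProjectiveFan d R}
  {k : Type*} [Field k]

section MinimalCover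

variable {N : Type*} [AddCommGroup N] [Module (X.Cox k) N]

lemma linearCombination_mem {𝒩 : X.Pic → AddSubgroup N}
    [SetLike.GradedSMul (X.coxGrading k) 𝒩] {b : ℕ} {a : Fin b → X.Pic} {y : Fin b → N}
    (hy : ∀ j, y j ∈ 𝒩 (a j)) (α : X.Pic) (x : Fin b → X.Cox k) (hx : x ∈ X.freeGrading k a α) :
    Fintype.linearCombination (X.Cox k) y x ∈ 𝒩 α := by
  rw [Fintype.linearCombination_apply]
  exact sum_mem fun j _ => X.smul_mem_graded k 𝒩 (sub_add_cancel _ _).symm (hx j) (hy j)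

variable (𝒩 : X.Pic → AddSubgroup N) [Decomposition 𝒩] {K : Submodule (X.Cox k) N}

lemma exists_homogeneous_generators (hK : K.FG) (hdec : ∀ x ∈ K, ∀ α, (decompose 𝒩 x α : N) ∈ K) :
    ∃ (b : ℕ) (a : Fin b → X.Pic) (y : Fin b → N), (∀ j, y j ∈ 𝒩 (a j)) ∧
      Submodule.span (X.Cox k) (Set.range y) = K := by
  classical
  have hspan : Submodule.span (X.Cox k) {x ∈ K | ∃ α, x ∈ 𝒩 α} = K := by
    refine le_antisymm (Submodule.span_le.mpr fun x hx => hx.1) fun x hx => ?_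
    rw [← sum_support_decompose 𝒩 x]
    exact sum_mem fun α _ => Submodule.subset_span ⟨hdec x hx α, α, SetLike.coe_mem _⟩
  obtain ⟨s, hs, hsspan⟩ := (Submodule.fg_span_iff_fg_span_finset_subset _).mp (hspan.symm ▸ hK)
  choose a ha using fun j => (hs (s.equivFin.symm j).2).2
  refine ⟨s.card, a, fun j => s.equivFin.symm j, ha, ?_⟩
  rw [← hspan, hsspan, ← Function.comp_def, EquivLike.range_comp, Subtype.range_coe]

variable [SetLike.GradedSMul (X.coxGrading k) 𝒩]

/- In a relation with a nonzero constant term the homogeneous component containing this term has a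
nonzero constant as a coefficient, so one of the generators is redundant. -/
lemma exists_minimal_cover (hK : K.FG) (hdec : ∀ x ∈ K, ∀ α, (decompose 𝒩 x α : N) ∈ K) :
    ∃ (b : ℕ) (a : Fin b → X.Pic) (f : (Fin b → X.Cox k) →ₗ[X.Cox k] N),
      (∀ α, ∀ x ∈ X.freeGrading k a α, f x ∈ 𝒩 α) ∧ LinearMap.range f = K ∧
      ∀ x, f x = 0 → ∀ j, (x j).coeff 0 = 0 := by
  classical
  have hex := exists_homogeneous_generators 𝒩 hK hdec
  obtain ⟨a, y, hy, hspan⟩ := Nat.find_spec hex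
  have hmin (m : ℕ) (hm : m < Nat.find hex) := Nat.find_min hex hm
  generalize Nat.find hex = b at *
  have hdeg := linearCombination_mem (k := k) hy
  refine ⟨b, a, _, hdeg, (Fintype.range_linearCombination _ _).trans hspan, fun x hx j => ?_⟩
  by_contra hj
  obtain ⟨α, hα⟩ : ∃ α,
      ((decompose (X.freeGrading k a) x α : Fin b → X.Cox k) j).coeff 0 ≠ 0 := by
    by_contra! hzero
    rw [← sum_support_decompose (X.freeGrading k a) x, Finset.sum_apply,
      MvPolynomial.coeff_sum] at hj
    exact hj (Finset.sum_eq_zero fun α _ => hzero α)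
  have hrel := map_decompose_eq_zero_of_injective (X.freeGrading k a) 𝒩 Function.injective_id
    hdeg hx α
  have hunit : IsUnit ((decompose (X.freeGrading k a) x α : Fin b → X.Cox k) j) := by
    rw [eq_C_of_coeff_zero_ne_zero ((decompose (X.freeGrading k a) x α).2 j) hα]
    exact (IsUnit.mk0 _ hα).map MvPolynomial.C
  obtain _ | b := b
  · exact j.elim0
  · exact hmin b b.lt_succ_self ⟨a ∘ j.succAbove, y ∘ j.succAbove, fun i => hy _,
      (span_range_comp_succAbove_eq hrel hunit).trans hspan⟩

end MinimalCover

section MinimalComplex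

variable (X k) in
/-- A homogeneous submodule of a graded free module `⨁ⱼ S(-aⱼ)`, from which the next step of a
minimal free resolution is constructed. -/
structure HomogeneousSyzygy where
  rank : ℕ
  twist : Fin rank → X.Pic
  submodule : Submodule (X.Cox k) (Fin rank → X.Cox k)
  decompose_mem : ∀ x ∈ submodule, ∀ α,
    (decompose (X.freeGrading k twist) x α : Fin rank → X.Cox k) ∈ submodule

lemma exists_homogeneousSyzygy {N : Type*} [AddCommGroup N] [Module (X.Cox k) N]
    (𝒩 : X.Pic → AddSubgroup N) [SetLike.GradedSMul (X.coxGrading k) 𝒩] [Decomposition 𝒩]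
    {K : Submodule (X.Cox k) N} (hK : K.FG) (hdec : ∀ x ∈ K, ∀ α, (decompose 𝒩 x α : N) ∈ K) :
    ∃ (s : X.HomogeneousSyzygy k) (f : (Fin s.rank → X.Cox k) →ₗ[X.Cox k] N),
      (∀ α, ∀ x ∈ X.freeGrading k s.twist α, f x ∈ 𝒩 α) ∧ LinearMap.range f = K ∧
      LinearMap.ker f = s.submodule ∧ ∀ x ∈ s.submodule, ∀ j, (x j).coeff 0 = 0 := by
  obtain ⟨b, a, f, hf, hrange, hmin⟩ := exists_minimal_cover 𝒩 hK hdec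
  exact ⟨⟨b, a, LinearMap.ker f, fun _ hx => map_decompose_eq_zero_of_injective
    (X.freeGrading k a) 𝒩 Function.injective_id hf hx⟩, f, hf, hrange, rfl, hmin⟩

lemma exists_minimal_freeComplex {M : Type*} [AddCommGroup M] [Module (X.Cox k) M]
    [Module.Finite (X.Cox k) M] (ℳ : X.Pic → AddSubgroup M)
    [SetLike.GradedSMul (X.coxGrading k) ℳ] [Decomposition ℳ] :
    ∃ (F : X.FreeComplex k) (η : (Fin (F.rank 0) → X.Cox k) →ₗ[X.Cox k] M),
      (∀ α, ∀ x ∈ F.grading 0 α, η x ∈ ℳ α) ∧ Function.Surjective η ∧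
      Function.Exact (F.diff 0) η ∧ (∀ i, Function.Exact (F.diff (i + 1)) (F.diff i)) ∧
      ∀ i x j, (F.diff i x j).coeff 0 = 0 := by
  obtain ⟨s₀, η, hη, hηrange, hηker, hmin₀⟩ :=
    exists_homogeneousSyzygy (k := k) ℳ Module.Finite.fg_top fun _ _ _ => Submodule.mem_top
  choose next f hf hrange hker hmin using fun s : X.HomogeneousSyzygy k =>
    exists_homogeneousSyzygy (X.freeGrading k s.twist) (IsNoetherian.noetherian s.submodule)
      s.decompose_mem
  let syz : ℕ → X.HomogeneousSyzygy k := fun i => Nat.rec s₀ (fun _ => next) i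
  have hsyz : ∀ i, ∀ x ∈ (syz i).submodule, ∀ j, (x j).coeff 0 = 0 := by
    rintro (_ | i)
    · exact hmin₀
    · exact hmin (syz i)
  have hexact (i : ℕ) : Function.Exact (f (syz (i + 1))) (f (syz i)) :=
    LinearMap.exact_iff.mpr ((hker (syz i)).trans (hrange (next (syz i))).symm)
  exact ⟨⟨fun i => (syz i).rank, fun i => (syz i).twist, fun i => f (syz i), fun i => hf (syz i),
    fun i => (hexact i).linearMap_comp_eq_zero⟩, η, hη, LinearMap.range_eq_top.mp hηrange,
    LinearMap.exact_iff.mpr (hηker.trans (hrange s₀).symm), hexact,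
    fun i x => hsyz i _ (hrange (syz i) ▸ LinearMap.mem_range_self _ x)⟩

end MinimalComplex

section ExactSections

variable {L : Type*} [AddCommGroup L] [Module (X.Cox k) L] {ℒ : X.Pic → AddSubgroup L}
  [SetLike.GradedSMul (X.coxGrading k) ℒ] [Decomposition ℒ]
  {M : Type*} [AddCommGroup M] [Module (X.Cox k) M] {ℳ : X.Pic → AddSubgroup M}
  [SetLike.GradedSMul (X.coxGrading k) ℳ] [Decomposition ℳ]

lemma surjective_sectionsMap {f : M →ₗ[X.Cox k] L} (hf : ∀ α, ∀ m ∈ ℳ α, f m ∈ ℒ α)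
    (h : Function.Surjective f) (σ : Finset R) :
    Function.Surjective (X.sectionsMap k ℳ ℒ f hf σ) := by
  intro z
  obtain ⟨n, m, hm, rfl⟩ := X.exists_eq_mkSection k ℒ z
  obtain ⟨x, hx, rfl⟩ := exists_mem_apply_eq ℳ ℒ hf hm (h m)
  exact ⟨X.mkSection k ℳ σ n x hx,
    Subtype.ext ((isInducedBy_sectionsMap hf).coe_apply_mkSection n x hx)⟩

variable {N : Type*} [AddCommGroup N] [Module (X.Cox k) N] {𝒩 : X.Pic → AddSubgroup N}
  [SetLike.GradedSMul (X.coxGrading k) 𝒩]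

lemma exact_sectionsMap {f : M →ₗ[X.Cox k] L} (hf : ∀ α, ∀ m ∈ ℳ α, f m ∈ ℒ α)
    {g : L →ₗ[X.Cox k] N} (hg : ∀ α, ∀ m ∈ ℒ α, g m ∈ 𝒩 α) (h : Function.Exact f g)
    (σ : Finset R) :
    Function.Exact (X.sectionsMap k ℳ ℒ f hf σ) (X.sectionsMap k ℒ 𝒩 g hg σ) := by
  have hf' := isInducedBy_sectionsMap (σ := σ) hf
  have hg' := isInducedBy_sectionsMap (σ := σ) hg
  intro z
  obtain ⟨n, m, hm, rfl⟩ := X.exists_eq_mkSection k ℒ z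
  constructor
  · intro hz
    rw [Subtype.ext_iff, hg'.coe_apply_mkSection] at hz
    obtain ⟨t, ht⟩ := mk_conePow_eq_zero_iff.mp hz
    have hmem : X.coneMonomial k σ ^ t • m ∈ ℒ ((t + n) • X.coneDeg σ) :=
      X.smul_mem_graded k ℒ (add_smul _ _ _) (X.coneMonomial_pow_mem k σ t) hm
    obtain ⟨x, hx, hxm⟩ := exists_mem_apply_eq ℳ ℒ hf hmem ((h _).mp ((map_smul g _ m).trans ht))
    refine ⟨X.mkSection k ℳ σ (t + n) x hx,
      Subtype.ext ((hf'.coe_apply_mkSection _ x hx).trans (mk_conePow_eq_iff.mpr ⟨0, ?_⟩))⟩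
    rw [hxm, smul_smul (X.coneMonomial k σ ^ n), ← pow_add, add_zero, add_comm]
  · intro hz
    obtain ⟨t, x, hx⟩ := hf'.exists_smul_mem_range hz
    refine Subtype.ext ((hg'.coe_apply_mkSection n m hm).trans
      (mk_conePow_eq_zero_iff.mpr ⟨t, ?_⟩))
    rw [← map_smul, ← hx, h.apply_apply_eq_zero]

lemma isVirtualResolution_of_exact {F : X.FreeComplex k}
    {η : (Fin (F.rank 0) → X.Cox k) →ₗ[X.Cox k] M} (hη : ∀ α, ∀ x ∈ F.grading 0 α, η x ∈ ℳ α)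
    (hsurj : Function.Surjective η) (hexact₀ : Function.Exact (F.diff 0) η)
    (hexact : ∀ i, Function.Exact (F.diff (i + 1)) (F.diff i)) : F.IsVirtualResolution ℳ := by
  refine ⟨⟨fun σ _ => X.sectionsMap k (F.grading 0) ℳ η hη σ, fun σ _ τ _ hτσ z => ?_⟩,
    fun σ _ => ⟨surjective_sectionsMap hη hsurj σ,
      exact_sectionsMap (F.diff_deg 0) hη hexact₀ σ,
      fun i => exact_sectionsMap (F.diff_deg (i + 1)) (F.diff_deg i) (hexact i) σ⟩⟩
  obtain ⟨n, m, hm, rfl⟩ := X.exists_eq_mkSection k _ z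
  refine Subtype.ext ?_
  change LocalizedModule.map _ η (X.locRes k _ hτσ (LocalizedModule.mk m (X.conePow k σ n))) =
    X.locRes k _ hτσ (LocalizedModule.map _ η (LocalizedModule.mk m (X.conePow k σ n)))
  simp only [locRes_mk, LocalizedModule.map_mk, map_smul]

end ExactSections

end SmoothProjectiveFan

section LocalizationAtPrime

open IsLocalRing

lemma HasDepthGE.of_le_localDepth {A : Type u} [CommRing A] [IsLocalRing A] [IsNoetherianRing A]
    [Small.{v} A] {N : Type v} [AddCommGroup N] [Module A N] [Module.Finite A N] {n : ℕ}
    (h : n ≤ localDepth A N) : HasDepthGE A N n := by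
  obtain _ | n := n
  · exact .zero N
  · have hlt : (n : ℕ∞) < localDepth A N := lt_of_lt_of_le (by exact_mod_cast n.lt_succ_self) h
    simp only [localDepth, lt_iSup_iff] at hlt
    obtain ⟨rs, hrs, hlt⟩ := hlt
    exact HasDepthGE.mono (.inr ⟨rs, rfl, hrs⟩) (by exact_mod_cast hlt)

lemma exists_mem_minimalPrimes_height_eq {A : Type*} [CommRing A] {I : Ideal A} (hI : I ≠ ⊤) :
    ∃ P ∈ I.minimalPrimes, P.height = I.height := by
  have := Ideal.nonempty_minimalPrimes hI
  rw [I.height_eq_inf_minimalPrimes, iInf_subtype']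
  obtain ⟨P, hP⟩ := csInf_mem (Set.range_nonempty fun P : I.minimalPrimes => P.1.height)
  exact ⟨P, P.2, hP⟩

lemma annihilator_localizedModule_le_map {A : Type*} [CommRing A] {T : Submonoid A} {M : Type*}
    [AddCommGroup M] [Module A M]
    (hM : Function.Injective (LocalizedModule.mkLinearMap T M)) :
    Module.annihilator (Localization T) (LocalizedModule T M) ≤
      (Module.annihilator A M).map (algebraMap A (Localization T)) := by
  rw [← IsLocalization.map_under T _ (Module.annihilator (Localization T) (LocalizedModule T M))]
  refine Ideal.map_mono fun a ha => Module.mem_annihilator.mpr fun m => hM ?_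
  rw [map_smul, map_zero, ← algebraMap_smul (Localization T)]
  exact Module.mem_annihilator.mp ha _

variable {A : Type*} [CommRing A] {P : Ideal A} [P.IsPrime]

lemma spanFinrank_le_height_add_supportDim {M : Type*} [AddCommGroup M]
    [Module A M] [Module.Finite A M] [IsRegularLocalRing (Localization.AtPrime P)]
    (hM : Function.Injective (LocalizedModule.mkLinearMap P.primeCompl M)) {Q : Ideal A}
    [Q.IsPrime] (hQ : Module.annihilator A M ≤ Q) (hQP : Q ≤ P) :
    ((maximalIdeal (Localization.AtPrime P)).spanFinrank : WithBot ℕ∞) ≤ Q.height +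
      Module.supportDim (Localization.AtPrime P) (LocalizedModule P.primeCompl M) := by
  have hdisj : Disjoint (P.primeCompl : Set A) Q :=
    Set.disjoint_left.mpr fun _ hP hQ => hP (hQP hQ)
  have := IsLocalization.isPrime_of_isPrime_disjoint P.primeCompl (Localization.AtPrime P) Q ‹_›
    hdisj
  refine ((HasDepthGE.of_isRegularLocalRing _).le_height_add_ringKrullDim_quotient
    (Q.map (algebraMap A (Localization.AtPrime P)))).trans ?_
  have hle := (annihilator_localizedModule_le_map hM).trans (Ideal.map_mono hQ)
  rw [IsLocalization.height_map_of_disjoint P.primeCompl Q hdisj,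
    Module.supportDim_eq_ringKrullDim_quotient_annihilator]
  gcongr
  exact ringKrullDim_le_of_surjective (Ideal.Quotient.factor hle)
    (Ideal.Quotient.factor_surjective hle)

lemma range_localizedModuleMap_le_maximalIdeal_smul_top {L : Type*} [AddCommGroup L] [Module A L]
    {ι : Type*} [Finite ι] {f : L →ₗ[A] ι → A} (hf : ∀ x i, f x i ∈ P) :
    LinearMap.range (LocalizedModule.map P.primeCompl f) ≤
      maximalIdeal (Localization.AtPrime P) •
        (⊤ : Submodule _ (LocalizedModule P.primeCompl (ι → A))) := by
  have := Fintype.ofFinite ι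
  classical
  rintro _ ⟨z, rfl⟩
  induction z using LocalizedModule.induction_on with
  | h x t =>
    rw [LocalizedModule.map_mk, pi_eq_sum_univ' (f x), localizedModule_mk_sum]
    refine Submodule.sum_mem _ fun i _ => ?_
    rw [← LocalizedModule.smul'_mk, ← algebraMap_smul (Localization.AtPrime P) (f x i)]
    exact Submodule.smul_mem_smul
      ((IsLocalization.AtPrime.to_map_mem_maximal_iff _ P _).mpr (hf x i)) Submodule.mem_top

end LocalizationAtPrime

namespace SmoothProjectiveFan

section Origin

variable {d : ℕ} {R : Type*} [Fintype R] [DecidableEq R] (X : SmoothProjectiveFan d R)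
  (k : Type*) [Field k]

/-- The ideal of the origin of `Spec S = k^R`. As `S` is positively graded, localization at this
ideal loses no information on graded modules. -/
noncomputable def originIdeal : Ideal (X.Cox k) :=
  RingHom.ker (MvPolynomial.constantCoeff : X.Cox k →+* k)

instance : (X.originIdeal k).IsPrime := RingHom.ker_isPrime _

variable {X k}

lemma mem_originIdeal {f : X.Cox k} : f ∈ X.originIdeal k ↔ f.coeff 0 = 0 := by
  rw [originIdeal, RingHom.mem_ker, MvPolynomial.constantCoeff_eq]

lemma FreeComplex.hasLengthLE_of_diff_eq_zero {F : X.FreeComplex k}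
    (hexact : ∀ i, Function.Exact (F.diff (i + 1)) (F.diff i))
    (hmin : ∀ i x j, F.diff i x j ∈ X.originIdeal k) {n : ℕ} (h : F.diff n = 0) :
    F.HasLengthLE n := by
  have hrank : ∀ i, F.diff i = 0 → F.rank (i + 1) = 0 := fun i hi => by
    by_contra hne
    let j : Fin (F.rank (i + 1)) := ⟨0, Nat.pos_of_ne_zero hne⟩
    obtain ⟨y, hy⟩ := (hexact i (Pi.single j 1)).mp (by rw [hi, LinearMap.zero_apply])
    have hj := hmin (i + 1) y j
    rw [hy, Pi.single_eq_same] at hj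
    exact (X.originIdeal k).one_notMem hj
  intro i hi
  induction i, hi using Nat.le_induction with
  | base => exact hrank n h
  | succ i _ ih =>
    have : IsEmpty (Fin (F.rank i)) := ih ▸ Fin.isEmpty
    exact hrank i (LinearMap.ext fun x => Subsingleton.elim _ _)

variable {M : Type*} [AddCommGroup M] [Module (X.Cox k) M]

lemma injective_mkLinearMap_originIdeal (ℳ : X.Pic → AddSubgroup M)
    [SetLike.GradedSMul (X.coxGrading k) ℳ] [DirectSum.Decomposition ℳ] :
    Function.Injective (LocalizedModule.mkLinearMap (X.originIdeal k).primeCompl M) := by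
  refine (injective_iff_map_eq_zero _).mpr fun m hm => ?_
  obtain ⟨f, hf, hfm⟩ := localizedModule_mk_eq_zero_iff.mp hm
  exact eq_zero_of_smul_eq_zero_of_coeff_zero_ne_zero ℳ (mt mem_originIdeal.mpr hf) hfm

lemma le_originIdeal_of_mem_associatedPrimes (ℳ : X.Pic → AddSubgroup M)
    [SetLike.GradedSMul (X.coxGrading k) ℳ] [DirectSum.Decomposition ℳ] {P : Ideal (X.Cox k)}
    (hP : P ∈ associatedPrimes (X.Cox k) M) : P ≤ X.originIdeal k := by
  intro f hf
  obtain ⟨x, hx, hfx⟩ := (biUnion_associatedPrimes_eq_zero_divisors (X.Cox k) M).subset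
    (Set.mem_biUnion hP hf)
  by_contra hne
  exact hx (eq_zero_of_smul_eq_zero_of_coeff_zero_ne_zero ℳ (mt mem_originIdeal.mpr hne) hfx)

lemma spanFinrank_le_codim_add_supportDim [Module.Finite (X.Cox k) M] [Nontrivial M]
    (ℳ : X.Pic → AddSubgroup M) [SetLike.GradedSMul (X.coxGrading k) ℳ]
    [DirectSum.Decomposition ℳ] :
    ((IsLocalRing.maximalIdeal (Localization.AtPrime (X.originIdeal k))).spanFinrank :
      WithBot ℕ∞) ≤ X.codim k M + Module.supportDim (Localization.AtPrime (X.originIdeal k))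
        (LocalizedModule (X.originIdeal k).primeCompl M) := by
  obtain ⟨Q, hQ, hheight⟩ := exists_mem_minimalPrimes_height_eq
    (mt (Module.annihilator_eq_top_iff (R := X.Cox k)).mp (not_subsingleton M))
  have := hQ.isPrime
  rw [codim, ← hheight]
  exact spanFinrank_le_height_add_supportDim (injective_mkLinearMap_originIdeal ℳ) hQ.1.2
    (le_originIdeal_of_mem_associatedPrimes ℳ
      (Module.associatedPrimes.minimalPrimes_annihilator_subset_associatedPrimes _ _ hQ))

variable [Module.Finite (X.Cox k) M] (ℳ : X.Pic → AddSubgroup M)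
  [SetLike.GradedSMul (X.coxGrading k) ℳ] [DirectSum.Decomposition ℳ]

lemma exists_isVirtualResolution_hasLengthLE {δ : ℕ}
    (hM : HasDepthGE (Localization.AtPrime (X.originIdeal k))
      (LocalizedModule (X.originIdeal k).primeCompl M) δ) :
    ∃ F : X.FreeComplex k, F.IsVirtualResolution ℳ ∧ F.HasLengthLE
      ((IsLocalRing.maximalIdeal (Localization.AtPrime (X.originIdeal k))).spanFinrank - δ) := by
  obtain ⟨F, η, hη, hsurj, hexact₀, hexact, hmin⟩ := exists_minimal_freeComplex (k := k) ℳ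
  simp_rw [← mem_originIdeal] at hmin
  refine ⟨F, isVirtualResolution_of_exact hη hsurj hexact₀ hexact,
    FreeComplex.hasLengthLE_of_diff_eq_zero hexact hmin ?_⟩
  set T := (X.originIdeal k).primeCompl
  have hfree (i : ℕ) : Module.Free (Localization.AtPrime (X.originIdeal k))
      (LocalizedModule T (Fin (F.rank i) → X.Cox k)) :=
    Module.free_of_isLocalizedModule T (LocalizedModule.mkLinearMap T _)
  have hexact₀' : Function.Exact (LocalizedModule.map T (F.diff 0)) (LocalizedModule.map T η) :=
    LocalizedModule.map_exact T _ _ hexact₀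
  have hsurj' : Function.Surjective (LocalizedModule.map T η) :=
    LocalizedModule.map_surjective T η hsurj
  have hdepth := hM.congr (hexact₀'.linearEquivOfSurjective hsurj').symm
  have hzero := eq_zero_of_minimal_resolution
    (F := fun i => LocalizedModule T (Fin (F.rank i) → X.Cox k))
    (f := fun i => LocalizedModule.map T (F.diff i))
    (fun i => LocalizedModule.map_exact T _ _ (hexact i))
    (fun i => range_localizedModuleMap_le_maximalIdeal_smul_top (hmin i)) hdepth
  refine LinearMap.ext fun x =>
    injective_mkLinearMap_originIdeal (X := X) (k := k) (F.grading _) ?_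
  rw [LinearMap.zero_apply, map_zero, LocalizedModule.mkLinearMap_apply,
    ← LocalizedModule.map_mk (S := T), hzero, LinearMap.zero_apply]

lemma IsArithmeticallyCM.vdim_le_codim [Nontrivial M] (h : X.IsArithmeticallyCM k M) :
    X.vdim k ℳ ≤ X.codim k M := by
  set A := Localization.AtPrime (X.originIdeal k)
  set N := LocalizedModule (X.originIdeal k).primeCompl M
  have hN : Nontrivial N := (injective_mkLinearMap_originIdeal ℳ).nontrivial
  have hCM : (localDepth A N : WithBot ℕ∞) = Module.supportDim A N :=
    (h ⟨X.originIdeal k, inferInstance⟩ hN).resolve_left (not_subsingleton N)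
  have hdim : Module.supportDim A N ≤ (IsLocalRing.maximalIdeal A).spanFinrank :=
    (Module.supportDim_le_ringKrullDim A N).trans_eq
      IsRegularLocalRing.spanFinrank_maximalIdeal.symm
  have hcodim := spanFinrank_le_codim_add_supportDim (k := k) ℳ
  rw [← hCM] at hdim hcodim
  obtain ⟨δ, hδ⟩ := ENat.ne_top_iff_exists.mp
    (ne_top_of_le_ne_top (ENat.natCast_ne_top _) (WithBot.coe_le_coe.mp hdim))
  obtain ⟨F, hF, hlen⟩ :=
    exists_isVirtualResolution_hasLengthLE ℳ (HasDepthGE.of_le_localDepth hδ.le)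
  calc X.vdim k ℳ
    _ ≤ ((IsLocalRing.maximalIdeal A).spanFinrank - δ : ℕ) := sInf_le ⟨F, _, hF, hlen, rfl⟩
    _ ≤ X.codim k M := by
      rw [ENat.natCast_sub, tsub_le_iff_right, hδ]
      exact WithBot.coe_le_coe.mp hcodim

theorem IsArithmeticallyCM.isVirtuallyCM (h : X.IsArithmeticallyCM k M) (hM : X.SheafNeZero k ℳ) :
    X.IsVirtuallyCM k ℳ := by
  obtain ⟨P, hP, -⟩ := exists_isRelevant_mem_support hM
  have : Nontrivial M := by
    by_contra hsub
    rw [not_nontrivial_iff_subsingleton] at hsub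
    exact (Module.support_eq_empty (R := X.Cox k)).subset hP
  exact ⟨hM, (h.vdim_le_codim ℳ).antisymm (codim_le_vdim hM)⟩

end Origin

end SmoothProjectiveFan

theorem mainTheorem7_general {k : Type*} [Field k] {d : ℕ} {R : Type*} [Fintype R] [DecidableEq R]
    (X : SmoothProjectiveFan d R) {M : Type*} [AddCommGroup M] [Module (X.Cox k) M]
    [Module.Finite (X.Cox k) M] (ℳ : X.Pic → AddSubgroup M) [DirectSum.Decomposition ℳ]
    [SetLike.GradedSMul (X.coxGrading k) ℳ] :
    (X.IsArithmeticallyCM k M → X.SheafNeZero k ℳ → X.IsVirtuallyCM k ℳ) ∧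
      (X.IsVirtuallyCM k ℳ → X.IsGeometricallyCM k M) :=
  ⟨fun h hM => h.isVirtuallyCM ℳ hM, fun h => h.isGeometricallyCM⟩

theorem mainTheorem7 {k : Type*} [Field k] [IsAlgClosed k] {d : ℕ} {R : Type*} [Fintype R]
    [DecidableEq R] (X : SmoothProjectiveFan d R)
    {M : Type*} [AddCommGroup M] [Module (X.Cox k) M] [Module.Finite (X.Cox k) M]
    (ℳ : X.Pic → AddSubgroup M) [DirectSum.Decomposition ℳ]
    [SetLike.GradedSMul (X.coxGrading k) ℳ] :
    (X.IsArithmeticallyCM k M → X.SheafNeZero k ℳ → X.IsVirtuallyCM k ℳ) ∧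
      (X.IsVirtuallyCM k ℳ → X.IsGeometricallyCM k M) := by
  exact mainTheorem7_general X ℳ
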